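/- Let $K$ be a complete discrete valuation field with normalized valuation $\mathrm{val}$, uniformizer $\pi$ and ring of integers $R$; an element of $K$ is handled through an approximation $x+O(\pi^{k})$, $O(\pi^k)=\pi^kR$, of absolute precision $k\in\mathbb Z\cup\{\infty\}$. Let $A=K[X_1,\dots,X_n]$, let $w$ be a monomial order on $A$, let $D\in\mathbb N$, and let $f_1,\dots,f_s\in A$ be homogeneous of degrees $d_1,\dots,d_s$, such that (H1) $(f_1,\dots,f_s)$ is a regular sequence; (H2) for $1\le i\le s$ the ideal $I_i=\langle f_1,\dots,f_i\rangle$ is a weakly-$w$-ideal: if $x^\alpha$ is a leading monomial of an element of the reduced Gröbner basis of $I_i$, every $x^\beta>_w x^\alpha$ with $|\beta|=|\alpha|$ is in $LM(I_i)$. *Precisions.* $Mac_d(f_1,\dots,f_i)$ is the matrix whose rows are the $x^\alpha f_j$, $j\le i$, $|\alpha|+d_j=d$, written in the monomials of degree $d$ in $w$-decreasing order; $\overline{Mac_d(f_1,\dots,f_i)}$ is obtained by discarding the rows $x^\alpha f_j$ with $x^\alpha\in LM(I_{j-1})$ (F5 criterion). Let $l_{d,i}$ be the greatest $l$ such that the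 first $l$ columns of $\overline{Mac_d(f_1,\dots,f_i)}$ are linearly independent. If the $f_i$ are in $R[X_1,\dots,X_n]$, let $prec_{Mac}$ (resp. $prec_{MF5}$) be the maximum over $d\le D$, $1\le i\le s$ of the smallest valuation of an $l_{d,i}$-minor on the first $l_{d,i}$ columns of $Mac_d(f_1,\dots,f_i)$ (resp. of $\overline{Mac_d(f_1,\dots,f_i)}$). *Weak Matrix algorithm.* For $d=0,\dots,D$ and $i=1,\dots,s$ a matrix $\widetilde M_{d,i}$ in row-echelon form (up to permutation) is computed. Let $N_{d,i}$ be the number of pairs $(j,\alpha)$ with $j\le i$, $|\alpha|+d_j=d$ and $x^\alpha$ not the leading monomial of a row of $\widetilde M_{d-d_j,j-1}$. The full approximate matrix $Mac_d(f_1',\dots,f_i')$ is reduced by Gaussian elimination, column by column, always with a certified non-zero pivot of smallest valuation and with exact zeros put in the eliminated entries, up to the first column without a certified non-zero pivot. The pivot rows found are completed by products of a variable and a row of $\widetilde M_{d-1,i}$ with new leading monomials to a matrix $\widetilde M_{d,i}$ with $N_{d,i}$ rows; if this is impossible an error is raised. The output consists of the rows with a new leading monomial. *Approximate bases.* A $D$-Gröbner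 basis of an ideal $I$ is a finite family of elements of $I$ such that the leading monomial of every non-zero homogeneous element of $I$ of degree at most $D$ is divisible by that of a non-zero member of the family. An approximate $D$-Gröbner basis of approximations $(f_1',\dots,f_s')$ is a finite list of approximate homogeneous polynomials $g_j'$, with precisions in $\mathbb Z_{\ge0}\cup\{\infty\}$, such that for every choice of homogeneous polynomials represented by the $f_i'$ there is a choice of polynomials represented by the $g_j'$ that is a $D$-Gröbner basis of the ideal generated by the former; and each $g_j'$ has an unambiguous leading monomial: its coefficient is certified to be non-zero and the coefficients at greater monomials of the same degree are exact zeros. **Theorem.** Let $(f_1',\dots,f_s')$ denote approximations of the $f_i$'s with precision $m\in\mathbb N$, that is, all coefficients are known with absolute precision at least $m$. 1. There is $m_0$, depending on the $f_i$, $D$ and $w$, such that for all $m\ge m_0$ and all such $(f_1',\dots,f_s')$ the weak Matrix algorithm raises no error and returns an approximate $D$-Gröbner basis of $(f_1',\dots,f_s')$. 2. If the $f_i$'s are in $R[X_1,\dots,X_n]$, then $prec_{Mac}\le prec_{MF5}$; for every $m>prec_{Mac}$ and all such $(f_1',\dots,f_s')$ the weak Matrix algorithm returns an approximate $D$-Gröbner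 basis of $(f_1',\dots,f_s')$, and all coefficients of its elements are known with absolute precision at least $m-prec_{Mac}$ (the loss in precision is at most $prec_{Mac}$). 3. The number of operations on approximate numbers (subtractions, multiplications, divisions, tests for non-zero, comparisons of valuations) that the weak Matrix algorithm performs is at most $C\,s^2D\binom{n+D-1}{D}^3$ for all $D\ge1$ and all $m$, with an absolute constant $C$. -/

import Mathlib

open MvPolynomial
open scoped Classical MonomialOrder

noncomputable section

namespace WeakMatrix

/-! ### Complete discrete valuation fields and approximate numbers -/

/-- `K` is complete for the normalized discrete valuation `v`. -/
structure IsCDVF {K : Type*} [Field K] (v : AddValuation K (WithTop ℤ)) : Prop where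
  exists_uniformizer : ∃ π : K, v π = ((1 : ℤ) : WithTop ℤ)
  complete : ∀ x : ℕ → K,
    (∀ N : ℤ, ∃ k₀ : ℕ, ∀ i j : ℕ, k₀ ≤ i → k₀ ≤ j → (N : WithTop ℤ) ≤ v (x i - x j)) →
    ∃ y : K, ∀ N : ℤ, ∃ k₀ : ℕ, ∀ i : ℕ, k₀ ≤ i → (N : WithTop ℤ) ≤ v (x i - y)

/-- An approximate number `x + O(π ^ prec)`, where `O(π ^ prec)` is the set of the elements of
valuation at least `prec`. It consists of the coset and of its absolute precision `prec`;
`prec = ⊤` is an exactly known number. No center of the coset is part of the data. -/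
structure Approx {K : Type*} [Field K] (v : AddValuation K (WithTop ℤ)) where
  carrier : Set K
  prec : WithTop ℤ
  isCoset : ∃ x : K, carrier = {y | prec ≤ v (y - x)}

namespace Approx

variable {K : Type*} [Field K] {v : AddValuation K (WithTop ℤ)}

/-- `x + O(π ^ p)`. -/
def mk' (v : AddValuation K (WithTop ℤ)) (x : K) (p : WithTop ℤ) : Approx v :=
  ⟨{y | p ≤ v (y - x)}, p, x, rfl⟩

instance : Membership K (Approx v) := ⟨fun a x => x ∈ a.carrier⟩

/-- The exact zero ("real zero"). -/
instance : Zero (Approx v) := ⟨mk' v 0 ⊤⟩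

/-- A chosen representative of the coset (a truncated expansion). -/
def center (a : Approx v) : K := a.isCoset.choose

/-- The known part of the valuation: the valuation of all elements of the coset if `0` is not
one of them, and the precision otherwise. -/
def val (a : Approx v) : WithTop ℤ := min (v a.center) a.prec

/-- The approximate number is certified to be non-zero. -/
def IsNonzero (a : Approx v) : Prop := (0 : K) ∉ a

/-- `(x + O(π ^ p)) - (y + O(π ^ q)) = x - y + O(π ^ min (p, q))`. -/
def sub (a b : Approx v) : Approx v :=
  mk' v (a.center - b.center) (min a.prec b.prec)

/-- `(x + O(π ^ p)) (y + O(π ^ q)) = x y + O(π ^ min (val x + q, val y + p))`. -/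
def mul (a b : Approx v) : Approx v :=
  mk' v (a.center * b.center) (min (a.val + b.prec) (b.val + a.prec))

/-- `(x + O(π ^ p)) / (y + O(π ^ q)) = x / y + O(π ^ min (p - val y, q + val x - 2 val y))`,
for a divisor certified to be non-zero. -/
def div (a b : Approx v) : Approx v :=
  mk' v (a.center / b.center)
    (min (a.prec - b.val) (b.prec + a.val - (b.val + b.val)))

end Approx

/-! ### Monomials and approximate polynomials -/

/-- Exponent vectors of the monomials in `n` variables. -/
abbrev Mon (n : ℕ) := Fin n →₀ ℕ

/-- The list of all monomials of degree `d`, in decreasing order for `w`. -/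
def monList {n : ℕ} (w : MonomialOrder (Fin n)) (d : ℕ) : List (Mon n) :=
  (((Finset.univ.finsuppAntidiag d).map w.toSyn.toEquiv.toEmbedding).sort
    (fun a b => b ≤ a)).map w.toSyn.symm

/-- An approximation of a homogeneous polynomial of degree `deg`. The entries of `coeff` at
monomials of another degree are irrelevant. -/
structure ApproxPoly {K : Type*} [Field K] (v : AddValuation K (WithTop ℤ)) (n : ℕ) where
  deg : ℕ
  coeff : Mon n → Approx v

namespace ApproxPoly

variable {K : Type*} [Field K] {v : AddValuation K (WithTop ℤ)} {n : ℕ}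

/-- `p` is one of the exact homogeneous polynomials that `P` approximates. -/
def Approximates (P : ApproxPoly v n) (p : MvPolynomial (Fin n) K) : Prop :=
  p.IsHomogeneous P.deg ∧ ∀ u : Mon n, u.degree = P.deg → p.coeff u ∈ P.coeff u

/-- All coefficients of `P` are known with absolute precision at least `m`. -/
def PrecGE (P : ApproxPoly v n) (m : WithTop ℤ) : Prop :=
  ∀ u : Mon n, u.degree = P.deg → m ≤ (P.coeff u).prec

/-- The product `x ^ α * P`; no operation on coefficients is needed. -/
def shift (α : Mon n) (P : ApproxPoly v n) : ApproxPoly v n :=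
  ⟨P.deg + α.degree, fun u => if α ≤ u then P.coeff (u - α) else 0⟩

/-- `x ^ u` is the leading monomial of `P`, unambiguously: its coefficient is certified to be
non-zero and the coefficients at all greater monomials of the same degree are exact zeros. -/
def HasLead (w : MonomialOrder (Fin n)) (P : ApproxPoly v n) (u : Mon n) : Prop :=
  u.degree = P.deg ∧ (P.coeff u).IsNonzero ∧
    ∀ x : Mon n, x.degree = P.deg → u ≺[w] x → P.coeff x = 0

end ApproxPoly

/-! ### Gröbner bases, weakly-`w`-ideals -/

section Groebner

variable {K : Type*} [Field K] {n s : ℕ}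

/-- The leading monomials of the non-zero elements of `I`. -/
def LM (w : MonomialOrder (Fin n)) (I : Ideal (MvPolynomial (Fin n) K)) : Set (Mon n) :=
  {u | ∃ p ∈ I, p ≠ 0 ∧ w.degree p = u}

/-- `g` is a `D`-Gröbner basis of `I`. -/
def IsDGroebner (w : MonomialOrder (Fin n)) (D : ℕ) (I : Ideal (MvPolynomial (Fin n) K))
    {r : ℕ} (g : Fin r → MvPolynomial (Fin n) K) : Prop :=
  (∀ j, g j ∈ I) ∧
    ∀ p ∈ I, p ≠ 0 → ∀ e ≤ D, p.IsHomogeneous e →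
      ∃ j, g j ≠ 0 ∧ w.degree (g j) ≤ w.degree p

/-- `G` is the reduced Gröbner basis of `I`. -/
def IsReducedGroebner (w : MonomialOrder (Fin n)) (I : Ideal (MvPolynomial (Fin n) K))
    (G : Finset (MvPolynomial (Fin n) K)) : Prop :=
  (∀ g ∈ G, g ∈ I ∧ g ≠ 0 ∧ w.leadingCoeff g = 1) ∧
  (∀ p ∈ I, p ≠ 0 → ∃ g ∈ G, w.degree g ≤ w.degree p) ∧
  (∀ g ∈ G, ∀ g' ∈ G, g' ≠ g → ∀ u ∈ g.support, ¬ w.degree g' ≤ u)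

/-- `I` is a weakly-`w`-ideal: if `x ^ α` is a leading monomial of the reduced Gröbner basis,
every greater monomial of the same degree is a leading monomial of `I`. -/
def IsWeaklyIdeal (w : MonomialOrder (Fin n)) (I : Ideal (MvPolynomial (Fin n) K)) : Prop :=
  ∃ G : Finset (MvPolynomial (Fin n) K), IsReducedGroebner w I G ∧
    ∀ g ∈ G, ∀ β : Mon n, β.degree = (w.degree g).degree → w.degree g ≺[w] β → β ∈ LM w I

/-- The ideal generated by the first `i` polynomials. -/
def idealUpTo (f : Fin s → MvPolynomial (Fin n) K) (i : ℕ) : Ideal (MvPolynomial (Fin n) K) :=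
  Ideal.span {p | ∃ j : Fin s, (j : ℕ) < i ∧ p = f j}

/-- `G` is an approximate `D`-Gröbner basis of the ideal generated by the approximate
polynomials `F`. -/
def IsApproxDGroebner {v : AddValuation K (WithTop ℤ)} (w : MonomialOrder (Fin n)) (D : ℕ)
    (F : Fin s → ApproxPoly v n) (G : List (ApproxPoly v n)) : Prop :=
  (∀ f : Fin s → MvPolynomial (Fin n) K, (∀ i, (F i).Approximates (f i)) →
    ∃ g : Fin G.length → MvPolynomial (Fin n) K, (∀ j, (G.get j).Approximates (g j)) ∧
      IsDGroebner w D (Ideal.span (Set.range f)) g) ∧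
  (∀ P ∈ G, P.PrecGE 0) ∧
  (∀ P ∈ G, ∃ u, P.HasLead w u)

end Groebner

/-! ### Macaulay matrices and the precisions attached to them -/

section Macaulay

variable {K : Type*} [Field K] {n s : ℕ}

/-- Labels `(j, α)` of the rows `x ^ α * f j` of the Macaulay matrix of degree `d` of the first
`i` polynomials, `deg j` being the degree of `f j`. -/
def MacRows (n : ℕ) (deg : Fin s → ℕ) (d i : ℕ) : Set (Fin s × Mon n) :=
  {p | (p.1 : ℕ) < i ∧ p.2.degree + deg p.1 = d}

/-- The rows that are kept by the F5 criterion: `x ^ α * f j` is discarded if `x ^ α` is a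
leading monomial of the ideal generated by the polynomials before `f j`. -/
def F5Rows (w : MonomialOrder (Fin n)) (f : Fin s → MvPolynomial (Fin n) K)
    (deg : Fin s → ℕ) (d i : ℕ) : Set (Fin s × Mon n) :=
  {p | p ∈ MacRows n deg d i ∧ p.2 ∉ LM w (idealUpTo f p.1)}

/-- The entry of the Macaulay matrix in the row `p` and in the column of the monomial `u`. -/
def macEntry (f : Fin s → MvPolynomial (Fin n) K) (p : Fin s × Mon n) (u : Mon n) : K :=
  (monomial p.2 (1 : K) * f p.1).coeff u

/-- The monomial that indexes the `b`-th column (counted from `0`) in degree `d`. -/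
def macCol (w : MonomialOrder (Fin n)) (d b : ℕ) : Mon n := (monList w d).getD b 0

/-- `l_{d,i}`: the greatest `l` such that the first `l` columns of the matrix with rows
`F5Rows w f deg d i` are linearly independent. -/
def indepCols (w : MonomialOrder (Fin n)) (f : Fin s → MvPolynomial (Fin n) K)
    (deg : Fin s → ℕ) (d i : ℕ) : ℕ :=
  sSup {l : ℕ | l ≤ (monList w d).length ∧
    LinearIndependent K (fun (b : Fin l) (p : F5Rows w f deg d i) =>
      macEntry f p.1 (macCol w d b))}

/-- The smallest valuation of an `l`-minor on the first `l` columns, over choices of `l` rows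
with labels in `S`. -/
def minMinorVal (v : AddValuation K (WithTop ℤ)) (w : MonomialOrder (Fin n))
    (f : Fin s → MvPolynomial (Fin n) K) (d : ℕ) (S : Set (Fin s × Mon n)) (l : ℕ) : ℕ :=
  sInf {k : ℕ | ∃ ρ : Fin l ↪ S,
    v (Matrix.of fun a b : Fin l => macEntry f (ρ a).1 (macCol w d b)).det
      = ((k : ℤ) : WithTop ℤ)}

/-- The Macaulay precision of `f`: maximum over `d ≤ D`, `1 ≤ i ≤ s`. -/
def precMac (v : AddValuation K (WithTop ℤ)) (w : MonomialOrder (Fin n)) (D : ℕ)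
    (f : Fin s → MvPolynomial (Fin n) K) (deg : Fin s → ℕ) : ℕ :=
  (Finset.range (D + 1) ×ˢ Finset.Icc 1 s).sup fun q =>
    minMinorVal v w f q.1 (MacRows n deg q.1 q.2) (indepCols w f deg q.1 q.2)

/-- The Matrix-F5 precision of `f`: maximum over `d ≤ D`, `1 ≤ i ≤ s`. -/
def precMF5 (v : AddValuation K (WithTop ℤ)) (w : MonomialOrder (Fin n)) (D : ℕ)
    (f : Fin s → MvPolynomial (Fin n) K) (deg : Fin s → ℕ) : ℕ :=
  (Finset.range (D + 1) ×ˢ Finset.Icc 1 s).sup fun q =>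
    minMinorVal v w f q.1 (F5Rows w f deg q.1 q.2) (indepCols w f deg q.1 q.2)

end Macaulay

/-! ### Computations with a count of operations -/

/-- A computation: its result (`none` if an error is raised) and the number of operations on
approximate numbers that were performed. -/
structure Comp (α : Type*) where
  result : Option α
  cost : ℕ

namespace Comp

/-- Sequential composition; the costs add up, and an error stops the computation. -/
def bind {α β : Type*} (x : Comp α) (f : α → Comp β) : Comp β :=
  match x.result with
  | none => ⟨none, x.cost⟩
  | some a => ⟨(f a).result, x.cost + (f a).cost⟩

instance : Monad Comp where
  pure a := ⟨some a, 0⟩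
  bind := bind

/-- Raise an error. -/
def error {α : Type*} : Comp α := ⟨none, 0⟩

/-- One counted operation with result `a`. -/
def op {α : Type*} (a : α) : Comp α := ⟨some a, 1⟩

end Comp

section Algorithm

universe u

variable {K : Type u} [Field K] {v : AddValuation K (WithTop ℤ)} {n s : ℕ}

/-! The elementary operations, of cost one each. -/

def subC (a b : Approx v) : Comp (Approx v) := Comp.op (a.sub b)

def mulC (a b : Approx v) : Comp (Approx v) := Comp.op (a.mul b)

def divC (a b : Approx v) : Comp (Approx v) := Comp.op (a.div b)

def isNonzeroC (a : Approx v) : Comp Bool := Comp.op (decide a.IsNonzero)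

def valLeC (a b : Approx v) : Comp Bool := Comp.op (decide (a.val ≤ b.val))

/-- Among the rows whose entry in column `c` is certified to be non-zero, find one for which
this entry has the smallest valuation; return it with the other rows, or `none` if there is no
non-zero pivot. -/
def findPivot (c : Mon n) :
    List (ApproxPoly v n) → Comp (Option (ApproxPoly v n × List (ApproxPoly v n)))
  | [] => pure none
  | r :: rs => (findPivot c rs).bind fun best => (isNonzeroC (r.coeff c)).bind fun nz =>
      match nz, best with
      | false, none => pure none
      | false, some (p, rest) => pure (some (p, r :: rest))
      | true, none => pure (some (r, rs))
      | true, some (p, rest) => (valLeC (r.coeff c) (p.coeff c)).bind fun le =>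
          match le with
          | true => pure (some (r, rs))
          | false => pure (some (p, r :: rest))

/-- Compute the coefficients of `row - q * piv` at the monomials of the given list, the other
ones being those of `base`. -/
def subMul (q : Approx v) (piv row base : Mon n → Approx v) :
    List (Mon n) → Comp (Mon n → Approx v)
  | [] => pure base
  | c :: cs => do
      let new ← subMul q piv row base cs
      let t ← mulC q (piv c)
      let x ← subC (row c) t
      pure (Function.update new c x)

/-- Eliminate the entry of `row` in column `c` with the pivot row `piv`: a real zero is put
there, and `row - (row c / piv c) * piv` is computed on the following columns `cs`. -/
def eliminate (c : Mon n) (cs : List (Mon n)) (piv row : ApproxPoly v n) :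
    Comp (ApproxPoly v n) := do
  let q ← divC (row.coeff c) (piv.coeff c)
  let new ← subMul q piv.coeff row.coeff (Function.update row.coeff c 0) cs
  pure ⟨row.deg, new⟩

/-- Eliminate the entries of all the rows in column `c`. -/
def eliminateAll (c : Mon n) (cs : List (Mon n)) (piv : ApproxPoly v n) :
    List (ApproxPoly v n) → Comp (List (ApproxPoly v n))
  | [] => pure []
  | r :: rs => do
      let r' ← eliminate c cs piv r
      let rs' ← eliminateAll c cs piv rs
      pure (r' :: rs')

/-- A row of an echelonized matrix together with its leading monomial. -/
structure EchRow {K : Type*} [Field K] (v : AddValuation K (WithTop ℤ)) (n : ℕ) where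
  lead : Mon n
  poly : ApproxPoly v n

/-- Gaussian elimination along the given list of columns, up to the first column without
non-zero pivot. The pivot rows are returned. -/
def echelon : List (Mon n) → List (ApproxPoly v n) → Comp (List (EchRow v n))
  | [], _ => pure []
  | c :: cs, rows => do
      let found ← findPivot c rows
      match found with
      | none => pure []
      | some (piv, rest) => do
          let rest' ← eliminateAll c cs piv rest
          let tail ← echelon cs rest'
          pure (⟨c, piv⟩ :: tail)

/-- The monomials `α` with `|α| + e = d`. -/
def cofactors (w : MonomialOrder (Fin n)) (d e : ℕ) : List (Mon n) :=
  if e ≤ d then monList w (d - e) else []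

/-- The rows of the full approximate Macaulay matrix of degree `d` of `F 0, …, F i`. -/
def macMatrix (w : MonomialOrder (Fin n)) (F : Fin s → ApproxPoly v n) (d : ℕ) (i : Fin s) :
    List (ApproxPoly v n) :=
  ((List.finRange s).filter (fun j => j ≤ i)).flatMap fun j =>
    (cofactors w d (F j).deg).map fun α => (F j).shift α

/-- The first multiple, by a variable, of one of the given rows with leading monomial `c`. -/
def multipleWithLead (prev : List (EchRow v n)) (c : Mon n) : Option (EchRow v n) :=
  prev.findSome? fun P => (List.finRange n).findSome? fun k =>
    if P.lead + Finsupp.single k 1 = c then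
      some ⟨c, P.poly.shift (Finsupp.single k 1)⟩ else none

/-- Complete the rows `ech`, whose leading monomials are the first columns, by multiples of the
rows `prev` of the previous degree, to a matrix with `N` rows in echelon form; raise an error if
this is impossible. -/
def complete (cols : List (Mon n)) (ech prev : List (EchRow v n)) (N : ℕ) :
    Comp (List (EchRow v n)) :=
  let M := ech ++
    (((cols.drop ech.length).filterMap (multipleWithLead prev)).take (N - ech.length))
  if M.length = N then pure M else Comp.error

/-- Add to `G` the rows with a new leading monomial. -/
def addNew (G rows : List (EchRow v n)) : List (EchRow v n) :=
  rows.foldl (fun G r => if ∃ g ∈ G, g.lead = r.lead then G else G ++ [r]) G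

/-- The state of the algorithm: `table d i` is the echelonized and completed matrix of degree
`d` of the first `i` polynomials (`[]` as long as it is not computed, and for `i = 0`), `mat` is
the matrix of the current degree built with the F5 criterion, `G` the basis found so far. -/
structure State {K : Type*} [Field K] (v : AddValuation K (WithTop ℤ)) (n : ℕ) where
  table : ℕ → ℕ → List (EchRow v n)
  mat : List (ApproxPoly v n)
  G : List (EchRow v n)

/-- The body of the inner loop: treat the polynomial `F i` in degree `d`. -/
def step (w : MonomialOrder (Fin n)) (F : Fin s → ApproxPoly v n) (d : ℕ)
    (st : State v n) (i : Fin s) : Comp (State v n) := do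
  let mat := st.mat ++ (((cofactors w d (F i).deg).filter
    (fun α => ¬ ∃ r ∈ st.table (d - (F i).deg) i, r.lead = α)).map fun α => (F i).shift α)
  let ech ← echelon (monList w d) (macMatrix w F d i)
  let prev := if d = 0 then [] else st.table (d - 1) (i + 1)
  let M ← complete (monList w d) ech prev mat.length
  pure ⟨Function.update st.table d (Function.update (st.table d) (i + 1) M), mat,
    addNew st.G M⟩

/-- The weak Matrix algorithm up to degree `D`. -/
def weakMatrix (w : MonomialOrder (Fin n)) (D : ℕ) (F : Fin s → ApproxPoly v n) :
    Comp (List (ApproxPoly v n)) := do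
  let st ← (List.range (D + 1)).foldlM
    (fun st d => (List.finRange s).foldlM (step w F d) { st with mat := [] })
    ⟨fun _ _ => [], [], []⟩
  pure (st.G.map EchRow.poly)

end Algorithm

/-- `F` is an approximation of `f`, of degrees `deg`, with precision `m` on the coefficients. -/
def IsApproxInput {K : Type*} [Field K] {v : AddValuation K (WithTop ℤ)} {n s : ℕ}
    (f : Fin s → MvPolynomial (Fin n) K) (deg : Fin s → ℕ) (m : ℕ)
    (F : Fin s → ApproxPoly v n) : Prop :=
  ∀ i, (F i).deg = deg i ∧ (F i).Approximates (f i) ∧ (F i).PrecGE ((m : ℤ) : WithTop ℤ)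

end WeakMatrix

end

noncomputable section

namespace WeakMatrix

universe u

/-! ### Approximate numbers, operation counts and elementary row operations -/

section

/-! ### Arithmetic of approximate numbers -/

/-! In each degree `d` and for each `i`, the leading monomials of the rows found are compared with
those of the ideal of `f` and with those of the ideal of any other choice `p` of represented
polynomials.

Elimination. Let the coefficients have valuation at least `-B` (`B = 0` in the integral case). A
pivot of least valuation `t` gives integral quotients, so using it costs at most `t + B` in
precision (`PrecLift.eliminated`). Meanwhile some minor on the remaining columns has valuation
smaller by at least `t` (`exists_minor_le`), even if the pivot row was not among the rows of the
chosen minor. The precision and the bound for the minor thus decrease in step, and a minor of small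
valuation on the first `l` columns forces `l` certified pivots with bounded loss (`echelon_prec`).
Conversely, pivots produce leading monomials of the ideal, and an initial segment of leading
monomials makes the corresponding columns independent, even with the F5 rows only
(`gradedPart_le_span_F5Rows`, `linearIndependent_cols`). Hence there are exactly `indepCols` pivots,
all with controlled precision.

Completion. In a weakly-`w`-ideal, a leading monomial beyond these columns is not that of an element
of the reduced Gröbner basis, hence is a variable times a leading monomial of the preceding degree
(`exists_add_single_of_isWeaklyIdeal`). By induction it is reached from the preceding matrix. The
number of rows is right because the dimension of the degree `d` part of an ideal is its number of
leading monomials (`finrank_gradedPart`), and adding a generator that is regular modulo the ideal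
adds exactly the F5 count.

Other representatives. Regularity and the weak property are known for `f` only. For any `p`,
however, all rows lift to the ideal of `p`, so their leading monomials belong to it, while adding an
arbitrary generator adds at most the F5 count (`finrank_gradedPart_sup_span_le`). By induction that
count is the same for `p` and `f`, so nothing is missing (`IsSetup.exists_complete`).

Cost. Only the eliminations are charged: each of the `(D + 1) * s` steps reduces at most `s * N`
rows on at most `N` columns, with `N` the number of monomials of degree `D`. -/

lemma withTop_sub_coe_le_sub_coe {x y : WithTop ℤ} (h : x ≤ y) (t : ℤ) :
    x - (t : WithTop ℤ) ≤ y - (t : WithTop ℤ) := by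
  induction y using WithTop.recTopCoe with
  | top => simp
  | coe y =>
    induction x using WithTop.recTopCoe with
    | top => simp at h
    | coe x =>
      have : x ≤ y := by exact_mod_cast h
      exact_mod_cast (by omega : x - t ≤ y - t)

lemma withTop_coe_sub_coe_le {x : ℤ} {y : WithTop ℤ} (h : (x : WithTop ℤ) ≤ y) (t : ℤ) :
    ((x - t : ℤ) : WithTop ℤ) ≤ y - (t : WithTop ℤ) := by
  simpa using withTop_sub_coe_le_sub_coe h t

lemma withTop_coe_add_coe_le {x y : ℤ} {a b : WithTop ℤ} (ha : (x : WithTop ℤ) ≤ a)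
    (hb : (y : WithTop ℤ) ≤ b) : ((x + y : ℤ) : WithTop ℤ) ≤ a + b := by
  rw [WithTop.coe_add]
  exact add_le_add ha hb

namespace Approx

variable {K : Type*} [Field K] {v : AddValuation K (WithTop ℤ)}

lemma mem_mk' {x y : K} {p : WithTop ℤ} : y ∈ mk' v x p ↔ p ≤ v (y - x) := Iff.rfl

@[simp] lemma prec_mk' {x : K} {p : WithTop ℤ} : (mk' v x p).prec = p := rfl

lemma mem_iff {a : Approx v} {y : K} : y ∈ a ↔ a.prec ≤ v (y - a.center) := by
  change y ∈ a.carrier ↔ _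
  conv_lhs => rw [a.isCoset.choose_spec]
  rfl

@[simp] lemma prec_zero : (0 : Approx v).prec = ⊤ := rfl

@[simp] lemma mem_zero {y : K} : y ∈ (0 : Approx v) ↔ y = 0 := by
  change (⊤ : WithTop ℤ) ≤ v (y - 0) ↔ _
  rw [top_le_iff, sub_zero, v.top_iff]

/-- By the ultrametric inequality, truncating the valuation at the precision removes the dependence
on the chosen center. -/
lemma val_eq {a : Approx v} {y : K} (hy : y ∈ a) : a.val = min (v y) a.prec := by
  have h := mem_iff.1 hy
  have e : y = a.center + (y - a.center) := by ring
  have e' : a.center = y - (y - a.center) := by ring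
  apply le_antisymm
  · refine le_min ?_ (min_le_right _ _)
    rw [e]
    exact v.map_le_add (min_le_left _ _) ((min_le_right _ _).trans h)
  · refine le_min ?_ (min_le_right _ _)
    rw [e']
    exact v.map_le_sub (min_le_left _ _) ((min_le_right _ _).trans h)

lemma val_le {a : Approx v} {y : K} (hy : y ∈ a) : a.val ≤ v y := by
  rw [val_eq hy]; exact min_le_left _ _

lemma center_mem (a : Approx v) : a.center ∈ a := by
  rw [mem_iff]; simp

/-- Any element of a coset is a center of it. This turns a bound on the valuation of an exact lift
into a certificate for the approximate entry. -/
lemma isNonzero_iff {a : Approx v} {y : K} (hy : y ∈ a) : a.IsNonzero ↔ v y < a.prec := by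
  have h := mem_iff.1 hy
  unfold IsNonzero
  rw [mem_iff, ← not_le, not_iff_not]
  constructor
  · intro h0
    have e : y = (y - a.center) - (0 - a.center) := by ring
    rw [e]
    exact v.map_le_sub h h0
  · intro h0
    have e : 0 - a.center = (y - a.center) - y := by ring
    rw [e]
    exact v.map_le_sub h h0

lemma val_eq_of_isNonzero {a : Approx v} {y : K} (hy : y ∈ a) (h : a.IsNonzero) :
    a.val = v y := by
  rw [val_eq hy, min_eq_left ((isNonzero_iff hy).1 h).le]

lemma ne_zero_of_isNonzero {a : Approx v} {y : K} (hy : y ∈ a) (h : a.IsNonzero) : y ≠ 0 := by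
  rintro rfl
  exact h hy

lemma sub_mem {a b : Approx v} {x y : K} (hx : x ∈ a) (hy : y ∈ b) : x - y ∈ a.sub b := by
  rw [sub, mem_mk']
  have e : x - y - (a.center - b.center) = (x - a.center) - (y - b.center) := by ring
  rw [e]
  exact v.map_le_sub ((min_le_left _ _).trans (mem_iff.1 hx))
    ((min_le_right _ _).trans (mem_iff.1 hy))

lemma mul_mem {a b : Approx v} {x y : K} (hx : x ∈ a) (hy : y ∈ b) : x * y ∈ a.mul b := by
  rw [mul, mem_mk']
  have e : x * y - a.center * b.center = x * (y - b.center) + b.center * (x - a.center) := by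
    ring
  rw [e]
  refine v.map_le_add ((min_le_left _ _).trans ?_) ((min_le_right _ _).trans ?_)
  · rw [v.map_mul]
    exact add_le_add (val_le hx) (mem_iff.1 hy)
  · rw [v.map_mul]
    exact add_le_add (val_le b.center_mem) (mem_iff.1 hx)

lemma div_mem {a b : Approx v} {x y : K} (hx : x ∈ a) (hy : y ∈ b) (hb : b.IsNonzero) :
    x / y ∈ a.div b := by
  rw [div, mem_mk']
  have hy0 := ne_zero_of_isNonzero hy hb
  have hc0 := ne_zero_of_isNonzero b.center_mem hb
  obtain ⟨t, ht⟩ := WithTop.ne_top_iff_exists.1 (v.ne_top_iff.2 hy0)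
  have hvy := val_eq_of_isNonzero hy hb
  have hvc := val_eq_of_isNonzero b.center_mem hb
  rw [hvy, ← ht] at hvc
  -- The two terms are the errors of the numerator and of the denominator; all elements of the
  -- divisor's coset have the same valuation `t`, which turns them into the two precisions in `div`.
  have e : x / y - a.center / b.center
      = (x - a.center) / y - (a.center * (y - b.center)) / (y * b.center) := by
    field_simp; ring
  rw [e, hvy, ← ht]
  refine v.map_le_sub ((min_le_left _ _).trans ?_) ((min_le_right _ _).trans ?_)
  · rw [v.map_div, ← ht]
    exact withTop_sub_coe_le_sub_coe (mem_iff.1 hx) t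
  · rw [v.map_div, v.map_mul, v.map_mul, ← ht, ← hvc, ← WithTop.coe_add]
    refine withTop_sub_coe_le_sub_coe ?_ _
    rw [add_comm]
    exact add_le_add (val_le a.center_mem) (mem_iff.1 hy)

end Approx

/-! ### Computations -/

namespace Comp

variable {α β : Type*}

@[simp] lemma result_bind (x : Comp α) (f : α → Comp β) :
    (Comp.bind x f).result = x.result.bind fun a => (f a).result := by
  unfold Comp.bind
  cases x.result <;> rfl

@[simp] lemma result_bind' {α β : Type _} (x : Comp α) (f : α → Comp β) :
    (x >>= f).result = x.result.bind fun a => (f a).result :=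
  result_bind x f

lemma cost_bind_le (x : Comp α) (f : α → Comp β) {a b : ℕ} (hx : x.cost ≤ a)
    (hf : ∀ y, x.result = some y → (f y).cost ≤ b) : (Comp.bind x f).cost ≤ a + b := by
  unfold Comp.bind
  cases h : x.result with
  | none => exact hx.trans (Nat.le_add_right _ _)
  | some y => exact Nat.add_le_add hx (hf y h)

lemma cost_bind_le' {α β : Type _} (x : Comp α) (f : α → Comp β) {a b : ℕ} (hx : x.cost ≤ a)
    (hf : ∀ y, x.result = some y → (f y).cost ≤ b) : (x >>= f).cost ≤ a + b :=
  cost_bind_le x f hx hf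

@[simp] lemma result_pure (a : α) : (pure a : Comp α).result = some a := rfl

@[simp] lemma cost_pure (a : α) : (pure a : Comp α).cost = 0 := rfl

@[simp] lemma result_op (a : α) : (op a).result = some a := rfl

@[simp] lemma cost_op (a : α) : (op a).cost = 1 := rfl

/-- A loop that preserves an invariant raises no error. -/
lemma exists_foldlM {σ β : Type _} (f : σ → β → Comp σ) (l : List β) (P : ℕ → σ → Prop) (a : σ)
    (h0 : P 0 a)
    (hstep : ∀ (k : ℕ) (hk : k < l.length) (b : σ), P k b →
      ∃ b', (f b l[k]).result = some b' ∧ P (k + 1) b') :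
    ∃ b, (l.foldlM f a).result = some b ∧ P l.length b := by
  induction l generalizing P a with
  | nil => exact ⟨a, rfl, h0⟩
  | cons x l ih =>
    obtain ⟨b, hb, hP⟩ := hstep 0 (by simp) a h0
    obtain ⟨c, hc, hPc⟩ := ih (fun k => P (k + 1)) b hP fun k hk b' hb' =>
      hstep (k + 1) (by simpa using hk) b' hb'
    refine ⟨c, ?_, hPc⟩
    rw [List.foldlM_cons, result_bind']
    simp only [List.getElem_cons_zero] at hb
    rw [hb]
    exact hc

lemma cost_foldlM_le {σ β : Type _} (f : σ → β → Comp σ) (l : List β) (c : ℕ)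
    (h : ∀ a, ∀ x ∈ l, (f a x).cost ≤ c) (a : σ) : (l.foldlM f a).cost ≤ l.length * c := by
  induction l generalizing a with
  | nil => simp
  | cons x l ih =>
    rw [List.foldlM_cons, List.length_cons, add_mul, one_mul, add_comm]
    exact cost_bind_le' _ _ (h a x (by simp)) fun y _ =>
      ih (fun a z hz => h a z (List.mem_cons_of_mem _ hz)) y

end Comp

/-! ### Results and costs of the elementary row operations -/

section RowOperations

variable {K : Type u} [Field K] {v : AddValuation K (WithTop ℤ)} {n : ℕ}

lemma result_subMul (q : Approx v) (piv row base : Mon n → Approx v) (cs : List (Mon n)) :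
    (subMul q piv row base cs).result
      = some fun u => if u ∈ cs then (row u).sub (q.mul (piv u)) else base u := by
  induction cs with
  | nil => simp [subMul]
  | cons c cs ih =>
    simp only [subMul, Comp.result_bind', ih, mulC, subC, Comp.result_op, Comp.result_pure,
      Option.bind_some, Option.some.injEq]
    funext x
    by_cases hx : x = c
    · subst hx; simp
    · simp [hx]

lemma cost_subMul_le (q : Approx v) (piv row base : Mon n → Approx v) (cs : List (Mon n)) :
    (subMul q piv row base cs).cost ≤ 2 * cs.length := by
  induction cs with
  | nil => simp [subMul]
  | cons c cs ih =>
    simp only [subMul]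
    refine (Comp.cost_bind_le' _ _ (b := 2) ih fun _ _ =>
      Comp.cost_bind_le' _ _ (a := 1) (b := 1) (by simp [mulC]) fun _ _ =>
        Comp.cost_bind_le' _ _ (a := 1) (b := 0) (by simp [subC]) (by simp)).trans ?_
    simp [mul_add]

/-- The row computed by `eliminate`. -/
def eliminated (c : Mon n) (cs : List (Mon n)) (piv row : ApproxPoly v n) : ApproxPoly v n :=
  ⟨row.deg, fun u => if u ∈ cs then
    (row.coeff u).sub (((row.coeff c).div (piv.coeff c)).mul (piv.coeff u))
    else if u = c then 0 else row.coeff u⟩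

lemma result_eliminate (c : Mon n) (cs : List (Mon n)) (piv row : ApproxPoly v n) :
    (eliminate c cs piv row).result = some (eliminated c cs piv row) := by
  simp [eliminate, divC, result_subMul, eliminated, Function.update_apply]

lemma cost_eliminate_le (c : Mon n) (cs : List (Mon n)) (piv row : ApproxPoly v n) :
    (eliminate c cs piv row).cost ≤ 1 + 2 * cs.length := by
  refine Comp.cost_bind_le' _ _ (a := 1) (by simp [divC]) fun _ _ => ?_
  exact Comp.cost_bind_le' _ _ (b := 0) (cost_subMul_le _ _ _ _ _) (by simp)

lemma result_eliminateAll (c : Mon n) (cs : List (Mon n)) (piv : ApproxPoly v n)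
    (rows : List (ApproxPoly v n)) :
    (eliminateAll c cs piv rows).result = some (rows.map (eliminated c cs piv)) := by
  induction rows with
  | nil => simp [eliminateAll]
  | cons r rs ih => simp [eliminateAll, ih, result_eliminate]

lemma cost_eliminateAll_le (c : Mon n) (cs : List (Mon n)) (piv : ApproxPoly v n)
    (rows : List (ApproxPoly v n)) :
    (eliminateAll c cs piv rows).cost ≤ rows.length * (1 + 2 * cs.length) := by
  induction rows with
  | nil => simp [eliminateAll]
  | cons r rs ih =>
    rw [List.length_cons, add_mul, one_mul, add_comm]
    simp only [eliminateAll]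
    refine Comp.cost_bind_le' _ _ (cost_eliminate_le _ _ _ _) fun _ _ => ?_
    exact Comp.cost_bind_le' _ _ (b := 0) ih (by simp)

/-- Stating the outcome up to `List.Perm` allows exact lifts of the rows to follow the reordering.
-/
lemma findPivot_spec (c : Mon n) (rows : List (ApproxPoly v n)) :
    ((findPivot c rows).result = some none ∧ ∀ r ∈ rows, ¬ (r.coeff c).IsNonzero) ∨
    ∃ piv rest, (findPivot c rows).result = some (some (piv, rest)) ∧
      (piv :: rest).Perm rows ∧ (piv.coeff c).IsNonzero ∧
      ∀ r ∈ rows, (r.coeff c).IsNonzero → (piv.coeff c).val ≤ (r.coeff c).val := by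
  induction rows with
  | nil => left; simp [findPivot]
  | cons r rs ih =>
    by_cases hr : (r.coeff c).IsNonzero
    · right
      rcases ih with ⟨h1, h2⟩ | ⟨piv, rest, h1, h2, h3, h4⟩
      · refine ⟨r, rs, ?_, .refl _, hr, ?_⟩
        · simp [findPivot, h1, isNonzeroC, hr]
        · intro x hx hx0
          rcases List.mem_cons.1 hx with rfl | hx
          · exact le_rfl
          · exact absurd hx0 (h2 x hx)
      · by_cases hle : (r.coeff c).val ≤ (piv.coeff c).val
        · refine ⟨r, rs, ?_, .refl _, hr, ?_⟩
          · simp [findPivot, h1, isNonzeroC, hr, valLeC, hle]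
          · intro x hx hx0
            rcases List.mem_cons.1 hx with rfl | hx
            · exact le_rfl
            · exact hle.trans (h4 x hx hx0)
        · refine ⟨piv, r :: rest, ?_, ?_, h3, ?_⟩
          · simp [findPivot, h1, isNonzeroC, hr, valLeC, hle]
          · exact (List.Perm.swap _ _ _).trans (h2.cons r)
          · intro x hx hx0
            rcases List.mem_cons.1 hx with rfl | hx
            · exact (not_le.1 hle).le
            · exact h4 x hx hx0
    · rcases ih with ⟨h1, h2⟩ | ⟨piv, rest, h1, h2, h3, h4⟩
      · left
        refine ⟨by simp [findPivot, h1, isNonzeroC, hr], ?_⟩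
        simpa [hr] using h2
      · right
        refine ⟨piv, r :: rest, ?_, (List.Perm.swap _ _ _).trans (h2.cons r), h3, ?_⟩
        · simp [findPivot, h1, isNonzeroC, hr]
        · intro x hx hx0
          rcases List.mem_cons.1 hx with rfl | hx
          · exact absurd hx0 hr
          · exact h4 x hx hx0

lemma cost_findPivot_le (c : Mon n) (rows : List (ApproxPoly v n)) :
    (findPivot c rows).cost ≤ 2 * rows.length := by
  induction rows with
  | nil => simp [findPivot]
  | cons r rs ih =>
    rw [List.length_cons, mul_add]
    refine Comp.cost_bind_le _ _ ih fun best _ => ?_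
    refine Comp.cost_bind_le _ _ (a := 1) (b := 1) (by simp [isNonzeroC]) fun nz _ => ?_
    rcases nz with _ | _ <;> rcases best with _ | ⟨p, rest⟩
    · simp
    · simp
    · simp
    · refine Comp.cost_bind_le _ _ (a := 1) (b := 0) (by simp [valLeC]) fun le _ => ?_
      cases le <;> simp

/-- The treatment of the first column by `echelon`. -/
lemma result_echelon_cons (c : Mon n) (cs : List (Mon n)) (rows : List (ApproxPoly v n)) :
    ((echelon (c :: cs) rows).result = some [] ∧ ∀ r ∈ rows, ¬ (r.coeff c).IsNonzero) ∨
    ∃ piv rest, (piv :: rest).Perm rows ∧ (piv.coeff c).IsNonzero ∧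
      (∀ r ∈ rows, (r.coeff c).IsNonzero → (piv.coeff c).val ≤ (r.coeff c).val) ∧
      (echelon (c :: cs) rows).result
        = (echelon cs (rest.map (eliminated c cs piv))).result.map (⟨c, piv⟩ :: ·) := by
  rcases findPivot_spec c rows with ⟨h1, h2⟩ | ⟨piv, rest, h1, h2, h3, h4⟩
  · left
    exact ⟨by simp [echelon, h1], h2⟩
  · right
    refine ⟨piv, rest, h2, h3, h4, ?_⟩
    simp only [echelon, Comp.result_bind', h1, Option.bind_some, result_eliminateAll]
    cases (echelon cs (rest.map (eliminated c cs piv))).result <;> rfl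

/-- One column costs at most a test and a comparison per row, then a division and two operations per
later column for each remaining row. The number of rows never grows. -/
lemma cost_echelon_le (cols : List (Mon n)) (rows : List (ApproxPoly v n)) :
    (echelon cols rows).cost ≤ cols.length * (rows.length * (3 + 2 * cols.length)) := by
  induction cols generalizing rows with
  | nil => simp [echelon]
  | cons c cs ih =>
    have hc : (echelon (c :: cs) rows).cost
        ≤ 2 * rows.length + (rows.length * (1 + 2 * cs.length)
          + cs.length * (rows.length * (3 + 2 * cs.length))) := by
      simp only [echelon]
      refine Comp.cost_bind_le' _ _ (cost_findPivot_le _ _) fun found hfound => ?_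
      rcases found with _ | ⟨piv, rest⟩
      · simp
      · have hlen : rest.length ≤ rows.length := by
          rcases findPivot_spec c rows with ⟨h1, _⟩ | ⟨piv', rest', h1, h2, _⟩
          · simp [h1] at hfound
          · rw [h1] at hfound
            obtain ⟨rfl, rfl⟩ : piv' = piv ∧ rest' = rest := by simpa using hfound
            have := h2.length_eq
            simp at this
            omega
        refine Comp.cost_bind_le' _ _ ((cost_eliminateAll_le _ _ _ _).trans
          (Nat.mul_le_mul_right _ hlen)) fun rest' hrest' => ?_
        rw [result_eliminateAll] at hrest'
        have hlen' : rest'.length ≤ rows.length := by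
          simp only [Option.some.injEq] at hrest'
          rw [← hrest']
          simpa using hlen
        refine (Comp.cost_bind_le' _ _ (b := 0) (ih rest') (by simp)).trans ?_
        rw [add_zero]
        gcongr
    refine hc.trans ?_
    simp only [List.length_cons]
    nlinarith [Nat.zero_le (cs.length * rows.length)]

end RowOperations

end

/-! ### Exact lifts of the elimination and the loss of precision -/

section

variable {K : Type u} [Field K] {v : AddValuation K (WithTop ℤ)} {n : ℕ}

/-! ### Exact lifts of the row operations -/

/-- The exact row operation lifted by `eliminated`. -/
def elimExact (c : Mon n) (piv row : MvPolynomial (Fin n) K) : MvPolynomial (Fin n) K :=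
  row - (row.coeff c / piv.coeff c) • piv

lemma coeff_elimExact (c u : Mon n) (piv row : MvPolynomial (Fin n) K) :
    (elimExact c piv row).coeff u = row.coeff u - row.coeff c / piv.coeff c * piv.coeff u := by
  simp [elimExact]

lemma elimExact_self {c : Mon n} {piv : MvPolynomial (Fin n) K} (h : piv.coeff c ≠ 0) :
    elimExact c piv piv = 0 := by
  simp [elimExact, div_self h]

/-- The rows of a matrix of degree `d` whose entries outside of the columns `cols` are exact
zeros. -/
def RowOn (d : ℕ) (cols : List (Mon n)) (P : ApproxPoly v n) : Prop :=
  P.deg = d ∧ ∀ u : Mon n, u.degree = d → u ∉ cols → P.coeff u = 0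

lemma RowOn.coeff_eq_zero {d : ℕ} {cols : List (Mon n)} {P : ApproxPoly v n}
    {p : MvPolynomial (Fin n) K} (h : RowOn d cols P) (hp : P.Approximates p) {u : Mon n}
    (hu : u ∉ cols) : p.coeff u = 0 := by
  by_cases hd : u.degree = d
  · have := hp.2 u (hd.trans h.1.symm)
    rwa [h.2 u hd hu, Approx.mem_zero] at this
  · exact hp.1.coeff_eq_zero (fun h' => hd (h'.trans h.1))

lemma RowOn.eliminated {d : ℕ} {c : Mon n} {cs : List (Mon n)} {row : ApproxPoly v n}
    (piv : ApproxPoly v n) (h : RowOn d (c :: cs) row) :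
    RowOn d cs (eliminated c cs piv row) := by
  refine ⟨h.1, fun u hu hucs => ?_⟩
  simp only [WeakMatrix.eliminated, hucs, if_false]
  split_ifs with huc
  · rfl
  · exact h.2 u hu (by simp [huc, hucs])

/-- The exact quotient is formed from the same lifts `r` and `p`, so the entry at `c` really cancels
and the exact zero put there is legitimate. Outside of the columns the pivot lift vanishes, so
leaving these entries alone is correct too. -/
lemma approximates_eliminated {d : ℕ} {c : Mon n} {cs : List (Mon n)}
    {row piv : ApproxPoly v n} {r p : MvPolynomial (Fin n) K} (hp : RowOn d (c :: cs) piv)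
    (hr : RowOn d (c :: cs) row) (hpp : piv.Approximates p) (hrr : row.Approximates r)
    (hc : (c : Mon n).degree = d) (hnz : (piv.coeff c).IsNonzero) :
    (eliminated c cs piv row).Approximates (elimExact c p r) := by
  have hrd := hr.1
  have hpd := hp.1
  refine ⟨?_, fun u hu => ?_⟩
  · change (elimExact c p r).IsHomogeneous row.deg
    rw [elimExact, smul_eq_C_mul]
    refine hrr.1.sub ?_
    have := hpp.1
    rw [hpd, ← hrd] at this
    exact this.C_mul _
  · change u.degree = row.deg at hu
    have hpu := hpp.2 u (by rw [hu, hrd, hpd])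
    have hru := hrr.2 u hu
    have hpc := hpp.2 c (by rw [hc, hpd])
    have hrc := hrr.2 c (by rw [hc, hrd])
    rw [coeff_elimExact]
    simp only [eliminated]
    split_ifs with h1 h2
    · exact Approx.sub_mem hru (Approx.mul_mem (Approx.div_mem hrc hpc hnz) hpu)
    · subst h2
      rw [Approx.mem_zero, div_mul_cancel₀ _ (Approx.ne_zero_of_isNonzero hpc hnz), sub_self]
    · rw [hp.coeff_eq_zero hpp (u := u) (by simp [h1, h2]), mul_zero, sub_zero]
      exact hru

/-- The pivot rows found by `echelon`: their leading monomials are the first columns, and they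
lift to any vector space to which the given rows lift. -/
lemma echelon_spec (w : MonomialOrder (Fin n)) (d : ℕ) (cols : List (Mon n))
    (hcols : cols.Pairwise fun a b => b ≺[w] a) (hd : ∀ u ∈ cols, u.degree = d)
    (rows : List (ApproxPoly v n)) (hrows : ∀ P ∈ rows, RowOn d cols P) :
    ∃ out, (echelon cols rows).result = some out ∧
      out.map EchRow.lead = cols.take out.length ∧
      (∀ E ∈ out, E.poly.deg = d ∧ E.poly.HasLead w E.lead) ∧
      ∀ V : Submodule K (MvPolynomial (Fin n) K),
        (∀ P ∈ rows, ∃ p ∈ V, P.Approximates p) →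
        ∀ E ∈ out, ∃ p ∈ V, E.poly.Approximates p := by
  induction cols generalizing rows with
  | nil => exact ⟨[], by simp [echelon], by simp, by simp, by simp⟩
  | cons c cs ih =>
    rcases result_echelon_cons c cs rows with ⟨h, -⟩ | ⟨piv, rest, hperm, hnz, -, hres⟩
    · exact ⟨[], h, by simp, by simp, by simp⟩
    · have hpiv : RowOn d (c :: cs) piv := hrows _ (hperm.subset (by simp))
      have hrest : ∀ P ∈ rest, RowOn d (c :: cs) P := fun P hP =>
        hrows _ (hperm.subset (by simp [hP]))
      obtain ⟨hc, hcs⟩ := List.pairwise_cons.1 hcols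
      obtain ⟨out, h1, h2, h3, h4⟩ := ih hcs (fun u hu => hd u (by simp [hu]))
        (rest.map (eliminated c cs piv)) (by
          intro P hP
          obtain ⟨Q, hQ, rfl⟩ := List.mem_map.1 hP
          exact (hrest Q hQ).eliminated piv)
      refine ⟨⟨c, piv⟩ :: out, by rw [hres, h1]; rfl, by simp [h2], ?_, ?_⟩
      · intro E hE
        rcases List.mem_cons.1 hE with rfl | hE
        -- A monomial greater than `c` is not in the decreasing list `c :: cs`, so `RowOn` makes the
        -- pivot's entry there an exact zero.
        · refine ⟨hpiv.1, (hd c (by simp)).trans hpiv.1.symm, hnz, fun x hx hcx => ?_⟩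
          refine hpiv.2 x (hx.trans hpiv.1) fun hmem => ?_
          rcases List.mem_cons.1 hmem with rfl | hmem
          · exact lt_irrefl _ hcx
          · exact lt_asymm hcx (hc x hmem)
        · exact h3 E hE
      · intro V hV E hE
        obtain ⟨p, hpV, hp⟩ := hV piv (hperm.subset (by simp))
        rcases List.mem_cons.1 hE with rfl | hE
        · exact ⟨p, hpV, hp⟩
        · refine h4 V ?_ E hE
          intro P hP
          obtain ⟨Q, hQ, rfl⟩ := List.mem_map.1 hP
          obtain ⟨q, hqV, hq⟩ := hV Q (hperm.subset (by simp [hQ]))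
          exact ⟨elimExact c p q, V.sub_mem hqV (V.smul_mem _ hpV),
            approximates_eliminated hpiv (hrest Q hQ) hp hq (hd c (by simp)) hnz⟩

/-! ### Valuations of minors -/

/-- Cofactor expansion: each term is a signed product of `l` entries, and signs have valuation zero.
-/
lemma le_val_det (v : AddValuation K (WithTop ℤ)) {l : ℕ} (A : Matrix (Fin l) (Fin l) K) (B : ℕ)
    (hA : ∀ i j, ((-(B : ℤ) : ℤ) : WithTop ℤ) ≤ v (A i j)) :
    ((-((l * B : ℕ) : ℤ) : ℤ) : WithTop ℤ) ≤ v A.det := by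
  induction l with
  | zero => simp
  | succ l ih =>
    rw [Matrix.det_succ_column_zero]
    refine v.map_le_sum fun i _ => ?_
    have h1 : v ((-1 : K) ^ (i : ℕ)) = 0 := by
      rw [v.map_pow, v.map_neg, v.map_one, smul_zero]
    rw [v.map_mul, v.map_mul, h1, zero_add]
    have := withTop_coe_add_coe_le (hA i 0)
      (ih (A.submatrix i.succAbove Fin.succ) fun i j => hA _ _)
    refine le_trans (le_of_eq ?_) this
    congr 1
    push_cast; ring

/-- Clearing the first column of a matrix with a row that need not belong to it: some minor of
the remaining columns has valuation at most that of the determinant minus that of the pivot. -/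
lemma exists_minor_le (v : AddValuation K (WithTop ℤ)) {l : ℕ}
    (A : Matrix (Fin (l + 1)) (Fin (l + 1)) K) (piv : Fin (l + 1) → K) (t M : ℤ)
    (ht : v (piv 0) = t) (hpiv : ∀ i, (t : WithTop ℤ) ≤ v (A i 0))
    (hM : v A.det ≤ M) :
    ∃ i : Fin (l + 1), v (Matrix.of fun a b : Fin l =>
      A (i.succAbove a) b.succ - A (i.succAbove a) 0 / piv 0 * piv b.succ).det
        ≤ ((M - t : ℤ) : WithTop ℤ) := by
  have hp0 : piv 0 ≠ 0 := by
    rw [← v.ne_top_iff, ht]; exact WithTop.coe_ne_top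
  -- Eliminating the rows with a foreign row `piv` is a column operation on `A`: column `j` loses
  -- `piv j / piv 0` times column `0`. This is why the determinant is preserved though `piv` need
  -- not be a row of `A`.
  set E : Matrix (Fin (l + 1)) (Fin (l + 1)) K := Matrix.of fun i j =>
    if j = 0 then A i 0 else A i j - A i 0 / piv 0 * piv j with hE
  have hdet : A.det = E.det := by
    rw [← Matrix.det_transpose A, ← Matrix.det_transpose E]
    refine Matrix.det_eq_of_forall_row_eq_smul_add_const
      (fun j => if j = 0 then 0 else piv j / piv 0) 0 (by simp) fun i j => ?_
    simp only [hE, Matrix.transpose_apply, Matrix.of_apply, if_true]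
    split_ifs with h
    · subst h; simp
    · field_simp; ring
  -- If every minor were too large, each term of the expansion along column `0`, whose entries have
  -- valuation at least `t`, would have valuation greater than `M`.
  by_contra! hcon
  have : (M : WithTop ℤ) < v E.det := by
    rw [Matrix.det_succ_column_zero]
    refine v.map_lt_sum WithTop.coe_ne_top fun i _ => ?_
    have h1 : v ((-1 : K) ^ (i : ℕ)) = 0 := by
      rw [v.map_pow, v.map_neg, v.map_one, smul_zero]
    rw [v.map_mul, v.map_mul, h1, zero_add]
    have hsub : E.submatrix i.succAbove Fin.succ = Matrix.of fun a b : Fin l =>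
        A (i.succAbove a) b.succ - A (i.succAbove a) 0 / piv 0 * piv b.succ := by
      ext a b
      simp [hE]
    rw [hsub]
    have hi := hcon i
    have h0 : (t : WithTop ℤ) ≤ v (E i 0) := by simpa [hE] using hpiv i
    calc (M : WithTop ℤ) = (t : WithTop ℤ) + ((M - t : ℤ) : WithTop ℤ) := by
          rw [← WithTop.coe_add]; congr 1; ring
      _ < (t : WithTop ℤ) + _ := WithTop.add_lt_add_left WithTop.coe_ne_top hi
      _ ≤ _ := by gcongr
  rw [hdet] at hM
  exact absurd hM (not_le.2 this)

/-! ### Loss of precision in the elimination -/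

/-- `P` approximates `p` with precision `μ`, the coefficients of `p` having valuation at least
`-B`. -/
def PrecLift (B : ℕ) (μ : ℤ) (P : ApproxPoly v n) (p : MvPolynomial (Fin n) K) : Prop :=
  P.Approximates p ∧ P.PrecGE (μ : WithTop ℤ) ∧
    ∀ u, ((-(B : ℤ) : ℤ) : WithTop ℤ) ≤ v (p.coeff u)

/-- Since `t` is minimal in the column, the quotient is integral and known to precision `μ - t`.
Multiplying it by a pivot entry of valuation at least `-B` leaves precision `μ - t - B`, and
integrality keeps the bound `-B` on the coefficients. -/
lemma PrecLift.eliminated {B d : ℕ} {μ t : ℤ} {c : Mon n} {cs : List (Mon n)}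
    {row piv : ApproxPoly v n} {r p : MvPolynomial (Fin n) K} (hp : RowOn d (c :: cs) piv)
    (hr : RowOn d (c :: cs) row) (hpp : PrecLift B μ piv p) (hrr : PrecLift B μ row r)
    (hc : (c : Mon n).degree = d) (hnz : (piv.coeff c).IsNonzero)
    (ht : v (p.coeff c) = t) (htμ : t < μ) (htr : (t : WithTop ℤ) ≤ v (r.coeff c)) :
    PrecLift B (μ - (t + B)) (WeakMatrix.eliminated c cs piv row) (elimExact c p r) := by
  have hrd := hr.1
  have hpd := hp.1
  have hBt : -(B : ℤ) ≤ t := by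
    have := hpp.2.2 c
    rw [ht] at this
    exact_mod_cast this
  have hp0 : p.coeff c ≠ 0 := by
    rw [← v.ne_top_iff, ht]; exact WithTop.coe_ne_top
  have hpc := hpp.1.2 c (by rw [hc, hpd])
  have hrc := hrr.1.2 c (by rw [hc, hrd])
  have hpval : (piv.coeff c).val = (t : WithTop ℤ) := by
    rw [Approx.val_eq_of_isNonzero hpc hnz, ht]
  have hx : (0 : WithTop ℤ) ≤ v (r.coeff c / p.coeff c) := by
    rw [v.map_div, ht]
    refine le_trans (le_of_eq ?_) (withTop_sub_coe_le_sub_coe htr t)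
    rw [← WithTop.LinearOrderedAddCommGroup.coe_sub, sub_self, WithTop.coe_zero]
  refine ⟨approximates_eliminated hp hr hpp.1 hrr.1 hc hnz, ?_, ?_⟩
  · intro u hu
    change u.degree = row.deg at hu
    have hpu := hpp.1.2 u (by rw [hu, hrd, hpd])
    have hru := hrr.1.2 u hu
    have hprecr := hrr.2.1 u hu
    have hprecp := hpp.2.1 u (by rw [hu, hrd, hpd])
    have hprecrc := hrr.2.1 c (by rw [hc, hrd])
    have hprecpc := hpp.2.1 c (by rw [hc, hpd])
    have hμ : ((μ - (t + B) : ℤ) : WithTop ℤ) ≤ (μ : WithTop ℤ) := by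
      exact_mod_cast (by omega : μ - (t + B) ≤ μ)
    simp only [WeakMatrix.eliminated]
    split_ifs with h1 h2
    · refine le_min (hμ.trans hprecr) ?_
      set q := (row.coeff c).div (piv.coeff c) with hq
      have hrval : (t : WithTop ℤ) ≤ (row.coeff c).val := by
        rw [Approx.val_eq hrc]
        refine le_min htr (le_trans ?_ hprecrc)
        exact_mod_cast htμ.le
      have hqprec : ((μ - t : ℤ) : WithTop ℤ) ≤ q.prec := by
        rw [hq, Approx.div, Approx.prec_mk', hpval]
        refine le_min (withTop_coe_sub_coe_le hprecrc t) ?_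
        rw [← WithTop.coe_add]
        refine le_trans (le_of_eq ?_)
          (withTop_coe_sub_coe_le (withTop_coe_add_coe_le hprecpc hrval) _)
        congr 1; ring
      have hqmem := Approx.div_mem hrc hpc hnz
      have hqval : ((0 : ℤ) : WithTop ℤ) ≤ q.val := by
        rw [Approx.val_eq hqmem]
        refine le_min hx (le_trans ?_ hqprec)
        exact_mod_cast (by omega : 0 ≤ μ - t)
      have hpuval : ((-(B : ℤ) : ℤ) : WithTop ℤ) ≤ (piv.coeff u).val := by
        rw [Approx.val_eq hpu]
        refine le_min (hpp.2.2 u) (le_trans ?_ hprecp)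
        exact_mod_cast (by omega : -(B : ℤ) ≤ μ)
      rw [Approx.mul, Approx.prec_mk']
      refine le_min (hμ.trans ?_) ?_
      · simpa using withTop_coe_add_coe_le hqval hprecp
      · refine le_trans (le_of_eq ?_) (withTop_coe_add_coe_le hpuval hqprec)
        congr 1; ring
    · simp
    · exact hμ.trans hprecr
  · intro u
    rw [coeff_elimExact]
    refine v.map_le_sub (hrr.2.2 u) ?_
    rw [v.map_mul]
    simpa using add_le_add hx (hpp.2.2 u)

/-- If the exact rows have a minor of small valuation on the first `l` columns, `echelon` finds
at least `l` pivots, and the loss of precision on the first `l` rows is bounded by its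
valuation. -/
lemma echelon_prec (d : ℕ) (B : ℕ) (cols : List (Mon n))
    (hd : ∀ u ∈ cols, u.degree = d) (rows : List (ApproxPoly v n))
    (hrows : ∀ P ∈ rows, RowOn d cols P) (exacts : List (MvPolynomial (Fin n) K)) (μ : ℤ)
    (hlift : List.Forall₂ (PrecLift B μ) rows exacts) (l : ℕ) (hl : l ≤ cols.length) (M : ℤ)
    (ρ : Fin l → MvPolynomial (Fin n) K) (hρ : ∀ a, ρ a ∈ exacts)
    (hdet : v (Matrix.of fun a b : Fin l => (ρ a).coeff (cols.getD b 0)).det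
      ≤ ((M - l * B : ℤ) : WithTop ℤ))
    (hM : M < μ + B) (out : List (EchRow v n)) (hout : (echelon cols rows).result = some out) :
    0 ≤ M ∧ l ≤ out.length ∧
      ∀ E ∈ out.take l, E.poly.PrecGE ((μ - M : ℤ) : WithTop ℤ) := by
  induction l generalizing cols rows exacts μ M out with
  | zero =>
    simp only [Matrix.det_isEmpty, v.map_one, Nat.cast_zero, zero_mul, sub_zero] at hdet
    exact ⟨by exact_mod_cast hdet, by simp, by simp⟩
  | succ l ih =>
    cases cols with
    | nil => simp at hl
    | cons c cs =>
      have hcd : c.degree = d := hd c (by simp)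
      have hexact : ∀ p ∈ exacts, ∃ P ∈ rows, PrecLift B μ P p := by
        intro p hp
        have := List.forall₂_iff_get.1 hlift
        obtain ⟨i, rfl⟩ := List.get_of_mem hp
        exact ⟨rows.get ⟨i, by rw [this.1]; exact i.2⟩, List.get_mem _ _,
          this.2 _ _ i.2⟩
      set A : Matrix (Fin (l + 1)) (Fin (l + 1)) K :=
        Matrix.of fun a b => (ρ a).coeff ((c :: cs).getD b 0) with hA
      have hA0 : ∀ i, A i 0 = (ρ i).coeff c := fun i => by simp [hA]
      have hAB : ∀ i j, ((-(B : ℤ) : ℤ) : WithTop ℤ) ≤ v (A i j) := fun i j => by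
        obtain ⟨P, -, hP⟩ := hexact _ (hρ i)
        exact hP.2.2 _
      -- Otherwise the determinant has valuation at least `μ - l * B`, against `hdet` and `M < μ +
      -- B`. An entry of valuation less than `μ` is certified non-zero, so a pivot exists.
      have hsmall : ∃ i, v (A i 0) < (μ : WithTop ℤ) := by
        by_contra! hcon
        have : ((μ - l * B : ℤ) : WithTop ℤ) ≤ v A.det := by
          rw [Matrix.det_succ_column_zero]
          refine v.map_le_sum fun i _ => ?_
          have h1 : v ((-1 : K) ^ (i : ℕ)) = 0 := by
            rw [v.map_pow, v.map_neg, v.map_one, smul_zero]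
          rw [v.map_mul, v.map_mul, h1, zero_add]
          refine le_trans (le_of_eq ?_) (withTop_coe_add_coe_le (hcon i)
            (le_val_det v (A.submatrix i.succAbove Fin.succ) B fun i j => hAB _ _))
          congr 1
        have := this.trans hdet
        have : μ - l * B ≤ M - ((l + 1 : ℕ) : ℤ) * B := by exact_mod_cast this
        push_cast at this
        linarith
      obtain ⟨i₀, hi₀⟩ := hsmall
      obtain ⟨P₀, hP₀, hP₀'⟩ := hexact _ (hρ i₀)
      have hP₀mem := hP₀'.1.2 c (by rw [hcd, (hrows _ hP₀).1])
      have hP₀nz : (P₀.coeff c).IsNonzero := by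
        rw [Approx.isNonzero_iff hP₀mem, ← hA0]
        exact hi₀.trans_le (hP₀'.2.1 c (by rw [hcd, (hrows _ hP₀).1]))
      rcases result_echelon_cons c cs rows with ⟨-, h⟩ | ⟨piv, rest, hperm, hnz, hmin, hres⟩
      · exact absurd hP₀nz (h _ hP₀)
      -- The exact lifts are permuted like the rows, so that the pivot and the rest have their own
      -- lifts.
      · obtain ⟨exacts', hlift', hperm'⟩ :
            Relation.Comp (List.Forall₂ (PrecLift B μ)) List.Perm (piv :: rest) exacts := by
          rw [List.forall₂_comp_perm_eq_perm_comp_forall₂]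
          exact ⟨rows, hperm, hlift⟩
        obtain ⟨p, ps, hpp, hrest', rfl⟩ := List.forall₂_cons_left_iff.1 hlift'
        have hpiv : RowOn d (c :: cs) piv := hrows _ (hperm.subset (by simp))
        have hrest : ∀ P ∈ rest, RowOn d (c :: cs) P := fun P hP =>
          hrows _ (hperm.subset (by simp [hP]))
        have hpmem := hpp.1.2 c (by rw [hcd, hpiv.1])
        have hp0 := Approx.ne_zero_of_isNonzero hpmem hnz
        obtain ⟨t, ht⟩ := WithTop.ne_top_iff_exists.1 (v.ne_top_iff.2 hp0)
        have hpval := Approx.val_eq_of_isNonzero hpmem hnz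
        have htμ : t < μ := by
          have h1 := hmin P₀ hP₀ hP₀nz
          rw [hpval, Approx.val_eq_of_isNonzero hP₀mem hP₀nz, ← ht, ← hA0] at h1
          exact_mod_cast h1.trans_lt hi₀
        have hBt : -(B : ℤ) ≤ t := by
          have := hpp.2.2 c
          rw [← ht] at this
          exact_mod_cast this
        -- The pivot is minimal only among certified entries; an uncertified one has valuation at
        -- least its precision, hence at least `μ > t`.
        have hmin' : ∀ (P : ApproxPoly v n) (q : MvPolynomial (Fin n) K), P ∈ rows →
            PrecLift B μ P q → (t : WithTop ℤ) ≤ v (q.coeff c) := by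
          intro P q hP hPq
          have hmem := hPq.1.2 c (by rw [hcd, (hrows _ hP).1])
          by_cases hnz' : (P.coeff c).IsNonzero
          · have h1 := hmin P hP hnz'
            rwa [hpval, Approx.val_eq_of_isNonzero hmem hnz', ← ht] at h1
          · rw [Approx.isNonzero_iff hmem, not_lt] at hnz'
            refine le_trans ?_ ((hPq.2.1 c (by rw [hcd, (hrows _ hP).1])).trans hnz')
            exact_mod_cast htμ.le
        have hdet' : v A.det ≤ ((M - ((l + 1 : ℕ) : ℤ) * B : ℤ) : WithTop ℤ) := hdet
        obtain ⟨i, hi⟩ := exists_minor_le v A (fun b => p.coeff ((c :: cs).getD b 0)) t _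
          (by simpa using ht.symm) (fun i => by
            obtain ⟨P, hP, hPq⟩ := hexact _ (hρ i)
            rw [hA0]
            exact hmin' P _ hP hPq) hdet'
        rw [hres] at hout
        obtain ⟨out', hout', rfl⟩ := Option.map_eq_some_iff.1 hout
        have hminor : Matrix.of (fun a b : Fin l =>
            A (i.succAbove a) b.succ - A (i.succAbove a) 0 / p.coeff ((c :: cs).getD (0 : Fin (l + 1)) 0) *
              p.coeff ((c :: cs).getD b.succ 0))
            = Matrix.of fun a b : Fin l =>
              (elimExact c p (ρ (i.succAbove a))).coeff (cs.getD b 0) := by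
          ext a b
          simp [coeff_elimExact, hA]
        rw [hminor] at hi
        have hmem : ∀ a, elimExact c p (ρ (i.succAbove a)) ∈ ps.map (elimExact c p) := by
          intro a
          rcases List.mem_cons.1 (hperm'.symm.subset (hρ (i.succAbove a))) with h | h
          -- If the pivot's lift is one of the rows of the new minor, its elimination gives a zero
          -- row, and the minor cannot have finite valuation.
          · exfalso
            rw [Matrix.det_eq_zero_of_row_eq_zero a, v.map_zero] at hi
            · exact WithTop.coe_ne_top (top_le_iff.1 hi)
            · intro b
              simp [h, elimExact_self hp0]
          · exact List.mem_map_of_mem h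
        -- Both `μ` and `M` decrease by `t + B`, so `μ - M` is invariant. Of this, `t` comes from
        -- the minor and `B` from its having one column fewer.
        obtain ⟨h1, h2, h3⟩ := ih cs (fun u hu => hd u (by simp [hu]))
          (rest.map (eliminated c cs piv)) (by
            intro P hP
            obtain ⟨Q, hQ, rfl⟩ := List.mem_map.1 hP
            exact (hrest Q hQ).eliminated piv)
          (ps.map (elimExact c p)) (μ - (t + B)) (by
            rw [List.forall₂_map_left_iff, List.forall₂_map_right_iff]
            rw [List.forall₂_iff_get] at hrest' ⊢
            refine ⟨hrest'.1, fun k hk hk' => ?_⟩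
            have hin : rest.get ⟨k, hk⟩ ∈ rest := List.get_mem _ _
            exact hpp.eliminated hpiv (hrest _ hin) (hrest'.2 k hk hk') hcd hnz ht.symm htμ
              (hmin' _ _ (hperm.subset (List.mem_cons_of_mem _ hin)) (hrest'.2 k hk hk')))
          (by simpa using hl) (M - (t + B)) _ hmem
          (hi.trans (le_of_eq (by congr 1; push_cast; ring))) (by linarith) out' hout'
        refine ⟨by linarith, by simpa using h2, ?_⟩
        intro E hE
        rw [List.take_succ_cons] at hE
        rcases List.mem_cons.1 hE with rfl | hE
        · intro u hu
          refine le_trans ?_ (hpp.2.1 u hu)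
          exact_mod_cast (by linarith : μ - M ≤ μ)
        · have := h3 E hE
          rwa [show μ - (t + B) - (M - (t + B)) = μ - M by ring] at this

end

/-! ### Graded parts, leading monomials and Hilbert functions -/

section

variable {K : Type*} [Field K] {n : ℕ}

/-! ### The list of monomials of a given degree -/

@[simp] lemma mem_monList {w : MonomialOrder (Fin n)} {d : ℕ} {u : Mon n} :
    u ∈ monList w d ↔ u.degree = d := by
  have h : (∑ i, u i = d) ↔ u.degree = d := by rw [Finsupp.degree_eq_sum]
  rw [← h]
  simp only [monList, List.mem_map, Finset.mem_sort, Finset.mem_map, Finset.mem_finsuppAntidiag]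
  constructor
  · rintro ⟨_, ⟨x, ⟨hx, -⟩, rfl⟩, rfl⟩
    simpa using hx
  · intro hu
    exact ⟨w.toSyn u, ⟨u, ⟨hu, Finset.subset_univ _⟩, rfl⟩, by simp⟩

lemma pairwise_monList (w : MonomialOrder (Fin n)) (d : ℕ) :
    (monList w d).Pairwise fun a b => b ≺[w] a := by
  rw [monList, List.pairwise_map]
  refine (List.Pairwise.and (Finset.pairwise_sort _ _)
    (Finset.sort_nodup _ (fun a b => b ≤ a))).imp ?_
  rintro a b ⟨h1, h2⟩
  simpa using lt_of_le_of_ne h1 (Ne.symm h2)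

lemma nodup_monList (w : MonomialOrder (Fin n)) (d : ℕ) : (monList w d).Nodup :=
  (pairwise_monList w d).imp fun h => by
    rintro rfl
    exact lt_irrefl _ h

lemma length_monList (w : MonomialOrder (Fin n)) (d : ℕ) :
    (monList w d).length = (n + d - 1).choose d := by
  rw [monList, List.length_map, Finset.length_sort, Finset.card_map,
    Finset.card_finsuppAntidiag_nat_eq_choose, Finset.card_univ, Fintype.card_fin]

/-! ### Homogeneous ideals -/

/-- `I` contains the homogeneous components of its elements. -/
def HomIdeal (I : Ideal (MvPolynomial (Fin n) K)) : Prop :=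
  ∀ d, ∀ p ∈ I, homogeneousComponent d p ∈ I

lemma homogeneousComponent_mul_right (b : MvPolynomial (Fin n) K) {g : MvPolynomial (Fin n) K}
    {e : ℕ} (hg : g.IsHomogeneous e) (d : ℕ) :
    homogeneousComponent (d + e) (b * g) = homogeneousComponent d b * g := by
  let _ : GradedAlgebra (homogeneousSubmodule (Fin n) K) := gradedAlgebra
  have h : ∀ (φ : MvPolynomial (Fin n) K) (i : ℕ),
      (DirectSum.decompose (homogeneousSubmodule (Fin n) K) φ i : MvPolynomial (Fin n) K)
        = homogeneousComponent i φ := fun φ i => decomposition.decompose'_apply φ i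
  rw [← h, ← h]
  exact DirectSum.coe_decompose_mul_add_of_right_mem _ hg

lemma homogeneousComponent_mul_right_of_lt (b : MvPolynomial (Fin n) K)
    {g : MvPolynomial (Fin n) K} {e d : ℕ} (hg : g.IsHomogeneous e) (hd : d < e) :
    homogeneousComponent d (b * g) = 0 := by
  let _ : GradedAlgebra (homogeneousSubmodule (Fin n) K) := gradedAlgebra
  have h : ∀ (φ : MvPolynomial (Fin n) K) (i : ℕ),
      (DirectSum.decompose (homogeneousSubmodule (Fin n) K) φ i : MvPolynomial (Fin n) K)
        = homogeneousComponent i φ := fun φ i => decomposition.decompose'_apply φ i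
  rw [← h]
  exact DirectSum.coe_decompose_mul_of_right_mem_of_not_le _ hg (not_le.2 hd)

lemma homIdeal_span {S : Set (MvPolynomial (Fin n) K)}
    (hS : ∀ p ∈ S, ∃ e, p.IsHomogeneous e) : HomIdeal (Ideal.span S) := by
  let _ : GradedAlgebra (homogeneousSubmodule (Fin n) K) := gradedAlgebra
  have h : ∀ (φ : MvPolynomial (Fin n) K) (i : ℕ),
      (DirectSum.decompose (homogeneousSubmodule (Fin n) K) φ i : MvPolynomial (Fin n) K)
        = homogeneousComponent i φ := fun φ i => decomposition.decompose'_apply φ i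
  intro d p hp
  rw [← h]
  exact Ideal.homogeneous_span (homogeneousSubmodule (Fin n) K) S (fun p hp => hS p hp) d hp

lemma homIdeal_top : HomIdeal (⊤ : Ideal (MvPolynomial (Fin n) K)) := fun _ _ _ => trivial

/-- The elements of degree `d` of an ideal. -/
def gradedPart (I : Ideal (MvPolynomial (Fin n) K)) (d : ℕ) :
    Submodule K (MvPolynomial (Fin n) K) :=
  I.restrictScalars K ⊓ homogeneousSubmodule (Fin n) K d

lemma mem_gradedPart {I : Ideal (MvPolynomial (Fin n) K)} {d : ℕ} {p : MvPolynomial (Fin n) K} :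
    p ∈ gradedPart I d ↔ p ∈ I ∧ p.IsHomogeneous d := by
  simp [gradedPart]

lemma HomIdeal.homogeneousComponent_mem {I : Ideal (MvPolynomial (Fin n) K)} (hI : HomIdeal I)
    {p : MvPolynomial (Fin n) K} (hp : p ∈ I) (d : ℕ) :
    homogeneousComponent d p ∈ gradedPart I d :=
  mem_gradedPart.2 ⟨hI d p hp, homogeneousComponent_isHomogeneous d p⟩

lemma homogeneousComponent_eq_self {p : MvPolynomial (Fin n) K} {d : ℕ}
    (hp : p.IsHomogeneous d) : homogeneousComponent d p = p := by
  rw [homogeneousComponent_of_mem hp, if_pos rfl]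

/-! ### Leading monomials -/

lemma degree_degree_of_isHomogeneous (w : MonomialOrder (Fin n)) {p : MvPolynomial (Fin n) K}
    {d : ℕ} (hp : p.IsHomogeneous d) (h0 : p ≠ 0) : (w.degree p).degree = d := by
  by_contra h
  exact (w.coeff_degree_ne_zero_iff.2 h0) (hp.coeff_eq_zero h)

lemma degree_eq_of_coeff (w : MonomialOrder (Fin n)) {p : MvPolynomial (Fin n) K} {u : Mon n}
    (hu : p.coeff u ≠ 0) (h : ∀ x, u ≺[w] x → p.coeff x = 0) : w.degree p = u := by
  have h0 : p ≠ 0 := by rintro rfl; simp at hu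
  apply w.toSyn.injective
  apply le_antisymm
  · by_contra hlt
    exact (w.coeff_degree_ne_zero_iff.2 h0) (h _ (not_le.1 hlt))
  · exact w.le_degree (mem_support_iff.2 hu)

/-- The order `w` need not be graded. The component in the degree of the leading monomial keeps that
monomial as its leading one, so homogeneous witnesses suffice. -/
lemma mem_LM_iff (w : MonomialOrder (Fin n)) {I : Ideal (MvPolynomial (Fin n) K)}
    (hI : HomIdeal I) {u : Mon n} :
    u ∈ LM w I ↔ ∃ p ∈ gradedPart I u.degree, p ≠ 0 ∧ w.degree p = u := by
  constructor
  · rintro ⟨p, hp, h0, rfl⟩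
    have hc : (homogeneousComponent (w.degree p).degree p).coeff (w.degree p) ≠ 0 := by
      rw [coeff_homogeneousComponent, if_pos rfl]
      exact w.coeff_degree_ne_zero_iff.2 h0
    refine ⟨homogeneousComponent (w.degree p).degree p, hI.homogeneousComponent_mem hp _, ?_,
      degree_eq_of_coeff w hc fun x hx => ?_⟩
    · intro h; simp [h] at hc
    · rw [coeff_homogeneousComponent, w.coeff_eq_zero_of_lt hx, ite_self]
  · rintro ⟨p, hp, h0, hu⟩
    exact ⟨p, (mem_gradedPart.1 hp).1, h0, hu⟩

lemma LM_upward (w : MonomialOrder (Fin n)) {I : Ideal (MvPolynomial (Fin n) K)} {u u' : Mon n}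
    (hu : u ∈ LM w I) (h : u ≤ u') : u' ∈ LM w I := by
  obtain ⟨p, hp, h0, rfl⟩ := hu
  have hm : monomial (u' - w.degree p) (1 : K) ≠ 0 := by simp
  refine ⟨monomial (u' - w.degree p) 1 * p, I.mul_mem_left _ hp, mul_ne_zero hm h0, ?_⟩
  rw [w.degree_mul hm h0, w.degree_monomial, if_neg one_ne_zero, tsub_add_cancel_of_le h]

lemma LM_bot (w : MonomialOrder (Fin n)) : LM w (⊥ : Ideal (MvPolynomial (Fin n) K)) = ∅ := by
  ext u
  simp only [LM, Set.mem_ofPred_eq, Set.mem_empty_iff_false, iff_false]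
  rintro ⟨p, hp, h0, -⟩
  exact h0 hp

lemma mem_LM_top (w : MonomialOrder (Fin n)) (u : Mon n) :
    u ∈ LM w (⊤ : Ideal (MvPolynomial (Fin n) K)) :=
  ⟨monomial u 1, trivial, by simp, by rw [w.degree_monomial, if_neg one_ne_zero]⟩

/-- The leading monomials of degree `d` of an ideal. -/
def lmFinset (w : MonomialOrder (Fin n)) (I : Ideal (MvPolynomial (Fin n) K)) (d : ℕ) :
    Finset (Mon n) :=
  (monList w d).toFinset.filter (· ∈ LM w I)

lemma mem_lmFinset {w : MonomialOrder (Fin n)} {I : Ideal (MvPolynomial (Fin n) K)} {d : ℕ}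
    {u : Mon n} : u ∈ lmFinset w I d ↔ u.degree = d ∧ u ∈ LM w I := by
  simp [lmFinset]

lemma card_lmFinset_top (w : MonomialOrder (Fin n)) (d : ℕ) :
    (lmFinset w (⊤ : Ideal (MvPolynomial (Fin n) K)) d).card = (monList w d).length := by
  rw [← List.toFinset_card_of_nodup (nodup_monList w d)]
  congr 1
  ext u
  simp [mem_lmFinset, mem_LM_top]

/-- Polynomials with distinct leading monomials are linearly independent. -/
lemma linearIndependent_of_degree {ι : Type*} [Fintype ι] (w : MonomialOrder (Fin n))
    (p : ι → MvPolynomial (Fin n) K) (h0 : ∀ i, p i ≠ 0)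
    (hinj : Function.Injective fun i => w.degree (p i)) : LinearIndependent K p := by
  rw [Fintype.linearIndependent_iff]
  intro g hg
  by_contra! hne
  obtain ⟨i₀, hi₀⟩ := hne
  obtain ⟨i, hi, hmax⟩ := Finset.exists_max_image (Finset.univ.filter fun i => g i ≠ 0)
    (fun i => w.toSyn (w.degree (p i))) ⟨i₀, by simpa using hi₀⟩
  have hc := congrArg (coeff (w.degree (p i))) hg
  rw [coeff_sum, Finset.sum_eq_single i, coeff_smul, coeff_zero, smul_eq_mul, mul_eq_zero] at hc
  · rcases hc with hc | hc
    · exact (Finset.mem_filter.1 hi).2 hc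
    · exact (w.coeff_degree_ne_zero_iff.2 (h0 i)) hc
  · intro j _ hji
    by_cases hj : g j = 0
    · simp [hj]
    · rw [coeff_smul, w.coeff_eq_zero_of_lt, smul_zero]
      refine lt_of_le_of_ne (hmax j (by simpa using hj)) fun h => hji (hinj ?_)
      exact w.toSyn.injective h
  · simp

/-- The coefficients of an element of degree `d` of `I` at the leading monomials of `I`. -/
def lmCoeffs (w : MonomialOrder (Fin n)) (I : Ideal (MvPolynomial (Fin n) K)) (d : ℕ) :
    gradedPart I d →ₗ[K] (lmFinset w I d → K) :=
  LinearMap.pi fun u => (lcoeff K u.1).comp (gradedPart I d).subtype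

/-- A non-zero element would have a zero coefficient at its own leading monomial. -/
lemma lmCoeffs_injective (w : MonomialOrder (Fin n)) (I : Ideal (MvPolynomial (Fin n) K))
    (d : ℕ) : Function.Injective (lmCoeffs w I d) := by
  rw [injective_iff_map_eq_zero]
  rintro ⟨p, hp⟩ h
  by_contra hne
  have h0 : p ≠ 0 := fun h => hne (by simp [h])
  have hp' := mem_gradedPart.1 hp
  have := congrFun h ⟨w.degree p, mem_lmFinset.2
    ⟨degree_degree_of_isHomogeneous w hp'.2 h0, p, hp'.1, h0, rfl⟩⟩
  exact (w.coeff_degree_ne_zero_iff.2 h0) this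

instance finite_gradedPart (I : Ideal (MvPolynomial (Fin n) K)) (d : ℕ) :
    Module.Finite K (gradedPart I d) :=
  -- Finiteness does not depend on the order; `lex` is an arbitrary choice.
  Module.Finite.of_injective (lmCoeffs MonomialOrder.lex I d) (lmCoeffs_injective _ I d)

/-- Coefficients at leading monomials determine an element, and one element for each leading
monomial gives an independent family. Counts of leading monomials thereby become dimensions. -/
lemma finrank_gradedPart (w : MonomialOrder (Fin n)) {I : Ideal (MvPolynomial (Fin n) K)}
    (hI : HomIdeal I) (d : ℕ) :
    Module.finrank K (gradedPart I d) = (lmFinset w I d).card := by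
  apply le_antisymm
  · have := LinearMap.finrank_le_finrank_of_injective (lmCoeffs_injective w I d)
    simpa using this
  · have h : ∀ u : lmFinset w I d, ∃ p ∈ gradedPart I d, p ≠ 0 ∧ w.degree p = u := by
      rintro ⟨u, hu⟩
      obtain ⟨hd, hu⟩ := mem_lmFinset.1 hu
      rw [mem_LM_iff w hI, hd] at hu
      exact hu
    choose p hp h0 hdeg using h
    have hli : LinearIndependent K p := by
      refine linearIndependent_of_degree w p h0 fun u u' huu' => Subtype.ext ?_
      simpa [hdeg] using huu'
    have hli' : LinearIndependent K fun u => (⟨p u, hp u⟩ : gradedPart I d) :=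
      LinearIndependent.of_comp (gradedPart I d).subtype hli
    simpa using hli'.fintype_card_le_finrank

/-! ### Adding a generator -/

lemma mem_gradedPart_sup_span {I : Ideal (MvPolynomial (Fin n) K)} (hI : HomIdeal I)
    {g : MvPolynomial (Fin n) K} {e : ℕ} (hg : g.IsHomogeneous e) (d : ℕ)
    {p : MvPolynomial (Fin n) K} (hp : p ∈ gradedPart (I ⊔ Ideal.span {g}) (d + e)) :
    ∃ a ∈ gradedPart I (d + e), ∃ b : MvPolynomial (Fin n) K, b.IsHomogeneous d ∧
      p = a + b * g := by
  obtain ⟨hp, hpd⟩ := mem_gradedPart.1 hp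
  obtain ⟨a, ha, c, hc, rfl⟩ := Submodule.mem_sup.1 hp
  obtain ⟨b, rfl⟩ := Ideal.mem_span_singleton'.1 hc
  refine ⟨_, hI.homogeneousComponent_mem ha (d + e), homogeneousComponent d b,
    homogeneousComponent_isHomogeneous _ _, ?_⟩
  conv_lhs => rw [← homogeneousComponent_eq_self hpd]
  rw [map_add, homogeneousComponent_mul_right b hg]

lemma gradedPart_sup_span_of_lt {I : Ideal (MvPolynomial (Fin n) K)} (hI : HomIdeal I)
    {g : MvPolynomial (Fin n) K} {e : ℕ} (hg : g.IsHomogeneous e) {d : ℕ} (hd : d < e) :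
    gradedPart (I ⊔ Ideal.span {g}) d = gradedPart I d := by
  apply le_antisymm
  · intro p hp
    obtain ⟨hp, hpd⟩ := mem_gradedPart.1 hp
    obtain ⟨a, ha, c, hc, rfl⟩ := Submodule.mem_sup.1 hp
    obtain ⟨b, rfl⟩ := Ideal.mem_span_singleton'.1 hc
    rw [← homogeneousComponent_eq_self hpd, map_add,
      homogeneousComponent_mul_right_of_lt b hg hd, add_zero]
    exact hI.homogeneousComponent_mem ha d
  · intro p hp
    obtain ⟨hp, hpd⟩ := mem_gradedPart.1 hp
    exact mem_gradedPart.2 ⟨Ideal.mem_sup_left hp, hpd⟩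

lemma gradedPart_sup_span {I : Ideal (MvPolynomial (Fin n) K)} (hI : HomIdeal I)
    {g : MvPolynomial (Fin n) K} {e : ℕ} (hg : g.IsHomogeneous e) (d : ℕ) :
    gradedPart (I ⊔ Ideal.span {g}) (d + e)
      = gradedPart I (d + e) ⊔ (gradedPart ⊤ d).map (LinearMap.mulRight K g) := by
  apply le_antisymm
  · intro p hp
    obtain ⟨a, ha, b, hb, rfl⟩ := mem_gradedPart_sup_span hI hg d hp
    exact Submodule.add_mem_sup ha
      ⟨b, mem_gradedPart.2 ⟨trivial, hb⟩, rfl⟩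
  · refine sup_le (fun p hp => ?_) ?_
    · obtain ⟨hp, hpd⟩ := mem_gradedPart.1 hp
      exact mem_gradedPart.2 ⟨Ideal.mem_sup_left hp, hpd⟩
    · rintro _ ⟨b, hb, rfl⟩
      exact mem_gradedPart.2 ⟨Ideal.mem_sup_right (Ideal.mem_span_singleton'.2 ⟨b, rfl⟩),
        (mem_gradedPart.1 hb).2.mul hg⟩

lemma finrank_map_mulRight {g : MvPolynomial (Fin n) K} (hg : g ≠ 0)
    (V : Submodule K (MvPolynomial (Fin n) K)) :
    Module.finrank K (V.map (LinearMap.mulRight K g)) = Module.finrank K V :=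
  (Submodule.equivMapOfInjective _ (fun _ _ h => mul_right_cancel₀ hg h) V).finrank_eq.symm

/-- In the dimension formula for the sum, the intersection always contains the trivial syzygies.
Regularity of `g` modulo `I` says that there are no others. -/
lemma map_gradedPart_le_inf (I : Ideal (MvPolynomial (Fin n) K))
    {g : MvPolynomial (Fin n) K} {e : ℕ} (hg : g.IsHomogeneous e) (d : ℕ) :
    (gradedPart I d).map (LinearMap.mulRight K g)
      ≤ gradedPart I (d + e) ⊓ (gradedPart ⊤ d).map (LinearMap.mulRight K g) := by
  rintro _ ⟨b, hb, rfl⟩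
  obtain ⟨hbI, hbd⟩ := mem_gradedPart.1 hb
  exact ⟨mem_gradedPart.2 ⟨I.mul_mem_right _ hbI, hbd.mul hg⟩,
    ⟨b, mem_gradedPart.2 ⟨trivial, hbd⟩, rfl⟩⟩

/-- Upper bound for the dimension of the degree `d + e` part after adding a generator of degree
`e`. -/
lemma finrank_gradedPart_sup_span_le {I : Ideal (MvPolynomial (Fin n) K)} (hI : HomIdeal I)
    {g : MvPolynomial (Fin n) K} {e : ℕ} (hg : g.IsHomogeneous e) (d : ℕ) :
    Module.finrank K (gradedPart (I ⊔ Ideal.span {g}) (d + e)) + Module.finrank K (gradedPart I d)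
      ≤ Module.finrank K (gradedPart I (d + e))
        + Module.finrank K (gradedPart (⊤ : Ideal (MvPolynomial (Fin n) K)) d) := by
  -- Multiplication by `0` is not injective, so this case is separate; an arbitrary representative
  -- may vanish.
  by_cases h0 : g = 0
  · subst h0
    have h1 : I ⊔ Ideal.span {(0 : MvPolynomial (Fin n) K)} = I := by simp
    rw [h1]
    gcongr
    exact Submodule.finrank_mono fun p hp =>
      mem_gradedPart.2 ⟨trivial, (mem_gradedPart.1 hp).2⟩
  · have h := Submodule.finrank_sup_add_finrank_inf_eq (gradedPart I (d + e))
      ((gradedPart ⊤ d).map (LinearMap.mulRight K g))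
    rw [← gradedPart_sup_span hI hg, finrank_map_mulRight h0] at h
    rw [← h]
    gcongr
    rw [← finrank_map_mulRight h0 (gradedPart I d)]
    exact Submodule.finrank_mono (map_gradedPart_le_inf I hg d)

/-- The bound is attained if the generator is regular modulo the ideal. -/
lemma finrank_gradedPart_sup_span {I : Ideal (MvPolynomial (Fin n) K)} (hI : HomIdeal I)
    {g : MvPolynomial (Fin n) K} {e : ℕ} (hg : g.IsHomogeneous e) (d : ℕ) (h0 : g ≠ 0)
    (hreg : ∀ b, b * g ∈ I → b ∈ I) :
    Module.finrank K (gradedPart (I ⊔ Ideal.span {g}) (d + e)) + Module.finrank K (gradedPart I d)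
      = Module.finrank K (gradedPart I (d + e))
        + Module.finrank K (gradedPart (⊤ : Ideal (MvPolynomial (Fin n) K)) d) := by
  have h := Submodule.finrank_sup_add_finrank_inf_eq (gradedPart I (d + e))
    ((gradedPart ⊤ d).map (LinearMap.mulRight K g))
  rw [← gradedPart_sup_span hI hg, finrank_map_mulRight h0] at h
  rw [← h, ← finrank_map_mulRight h0 (gradedPart I d)]
  have heq : (gradedPart I d).map (LinearMap.mulRight K g)
      = gradedPart I (d + e) ⊓ (gradedPart ⊤ d).map (LinearMap.mulRight K g) := by
    refine le_antisymm (map_gradedPart_le_inf I hg d) ?_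
    rintro _ ⟨h1, b, hb, rfl⟩
    exact ⟨b, mem_gradedPart.2 ⟨hreg b (mem_gradedPart.1 h1).1, (mem_gradedPart.1 hb).2⟩, rfl⟩
  rw [heq]

/-- Macaulay's basis theorem, spanning part: a polynomial of degree `d` is the sum of an element
of `I` and of a combination of monomials outside of `LM w I`. -/
lemma exists_normalForm (w : MonomialOrder (Fin n)) {I : Ideal (MvPolynomial (Fin n) K)}
    (hI : HomIdeal I) {d : ℕ} {b : MvPolynomial (Fin n) K} (hb : b.IsHomogeneous d) :
    ∃ a ∈ I, ∃ r : MvPolynomial (Fin n) K, b = a + r ∧ r.IsHomogeneous d ∧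
      ∀ u ∈ r.support, u ∉ LM w I := by
  -- Dividing by all non-zero elements of `I` at once makes the remainder avoid every leading
  -- monomial of `I`.
  obtain ⟨g, r, h1, -, h3⟩ := w.div_set (B := {p | p ∈ I ∧ p ≠ 0}) (fun p hp =>
    (w.leadingCoeff_ne_zero_iff.2 hp.2).isUnit) b
  have hmem : Finsupp.linearCombination (MvPolynomial (Fin n) K)
      (fun p : {p | p ∈ I ∧ p ≠ 0} => (p : MvPolynomial (Fin n) K)) g ∈ I := by
    rw [Finsupp.linearCombination_apply]
    exact I.sum_mem fun p _ => I.mul_mem_left _ p.2.1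
  refine ⟨_, hI d _ hmem, homogeneousComponent d r, ?_, homogeneousComponent_isHomogeneous _ _, ?_⟩
  · conv_lhs => rw [← homogeneousComponent_eq_self hb, h1, map_add]
  · intro u hu hLM
    obtain ⟨p, hp, h0, rfl⟩ := hLM
    refine h3 (w.degree p) ?_ p ⟨hp, h0⟩ le_rfl
    rw [mem_support_iff, coeff_homogeneousComponent] at hu
    rw [mem_support_iff]
    exact (ite_ne_right_iff.1 hu).2

end

/-! ### The F5 criterion, minors and weakly-`w`-ideals -/

section

variable {K : Type*} [Field K] {n s : ℕ}

/-! ### The ideals generated by the first polynomials -/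

lemma idealUpTo_zero (f : Fin s → MvPolynomial (Fin n) K) : idealUpTo f 0 = ⊥ := by
  rw [idealUpTo, Ideal.span_eq_bot]
  rintro p ⟨j, hj, -⟩
  exact absurd hj (Nat.not_lt_zero _)

lemma idealUpTo_succ (f : Fin s → MvPolynomial (Fin n) K) (i : Fin s) :
    idealUpTo f (i + 1) = idealUpTo f i ⊔ Ideal.span {f i} := by
  rw [idealUpTo, idealUpTo, ← Ideal.span_union]
  congr 1
  ext p
  constructor
  · rintro ⟨j, hj, rfl⟩
    rcases Nat.lt_succ_iff_lt_or_eq.1 hj with h | h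
    · exact Or.inl ⟨j, h, rfl⟩
    · exact Or.inr (by rw [Fin.ext h]; rfl)
  · rintro (⟨j, hj, rfl⟩ | hp)
    · exact ⟨j, by omega, rfl⟩
    · exact ⟨i, by omega, hp⟩

lemma idealUpTo_last (f : Fin s → MvPolynomial (Fin n) K) :
    idealUpTo f s = Ideal.span (Set.range f) := by
  rw [idealUpTo]
  congr 1
  ext p
  constructor
  · rintro ⟨j, -, rfl⟩
    exact ⟨j, rfl⟩
  · rintro ⟨j, rfl⟩
    exact ⟨j, j.2, rfl⟩

lemma idealUpTo_mono (f : Fin s → MvPolynomial (Fin n) K) {i j : ℕ} (h : i ≤ j) :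
    idealUpTo f i ≤ idealUpTo f j :=
  Ideal.span_mono fun _ ⟨k, hk, hp⟩ => ⟨k, hk.trans_le h, hp⟩

lemma mem_idealUpTo (f : Fin s → MvPolynomial (Fin n) K) {j : Fin s} {i : ℕ} (h : (j : ℕ) < i) :
    f j ∈ idealUpTo f i :=
  Ideal.subset_span ⟨j, h, rfl⟩

lemma homIdeal_idealUpTo {f : Fin s → MvPolynomial (Fin n) K} {deg : Fin s → ℕ}
    (hf : ∀ i, (f i).IsHomogeneous (deg i)) (i : ℕ) : HomIdeal (idealUpTo f i) :=
  homIdeal_span (by rintro p ⟨j, -, rfl⟩; exact ⟨_, hf j⟩)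

/-! ### The Hilbert function and the F5 criterion -/

/-- The number of rows `x ^ α * g` of degree `d` kept by the F5 criterion, if `g` of degree `e`
is added to the ideal `I`. -/
def f5Count (w : MonomialOrder (Fin n)) (I : Ideal (MvPolynomial (Fin n) K)) (d e : ℕ) : ℕ :=
  ((cofactors w d e).filter fun α => α ∉ LM w I).length

lemma f5Count_add (w : MonomialOrder (Fin n)) (I : Ideal (MvPolynomial (Fin n) K)) (d e : ℕ) :
    f5Count w I (d + e) e + (lmFinset w I d).card
      = (lmFinset w (⊤ : Ideal (MvPolynomial (Fin n) K)) d).card := by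
  rw [card_lmFinset_top, f5Count, cofactors, if_pos (Nat.le_add_left _ _), Nat.add_sub_cancel]
  have h : (lmFinset w I d).card = ((monList w d).filter fun α => α ∈ LM w I).length := by
    rw [← List.toFinset_card_of_nodup ((nodup_monList w d).filter _), lmFinset]
    congr 1
    ext u
    simp
  rw [h, add_comm]
  have := List.length_eq_length_filter_add (l := monList w d) (fun α => decide (α ∈ LM w I))
  rw [this]
  congr 2
  exact List.filter_congr fun x _ => by simp

lemma f5Count_of_lt (w : MonomialOrder (Fin n)) (I : Ideal (MvPolynomial (Fin n) K)) {d e : ℕ}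
    (h : d < e) : f5Count w I d e = 0 := by
  rw [f5Count, cofactors, if_neg (not_le.2 h)]
  rfl

/-- No regularity is assumed, so this applies to every choice of polynomials represented by the
input. -/
lemma card_lmFinset_sup_span_le (w : MonomialOrder (Fin n)) {I J : Ideal (MvPolynomial (Fin n) K)}
    (hI : HomIdeal I) {g : MvPolynomial (Fin n) K} {e : ℕ} (hg : g.IsHomogeneous e)
    (hJ : HomIdeal J) (hJI : J = I ⊔ Ideal.span {g}) (d : ℕ) :
    (lmFinset w J d).card ≤ (lmFinset w I d).card + f5Count w I d e := by
  rcases lt_or_ge d e with h | h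
  · rw [f5Count_of_lt w I h, ← finrank_gradedPart w hI, ← finrank_gradedPart w hJ, hJI,
      gradedPart_sup_span_of_lt hI hg h]
    exact le_rfl
  · obtain ⟨d, rfl⟩ := Nat.exists_eq_add_of_le' h
    have h1 := finrank_gradedPart_sup_span_le hI hg d
    rw [← hJI, finrank_gradedPart w hI, finrank_gradedPart w hI, finrank_gradedPart w hJ,
      finrank_gradedPart w homIdeal_top, ← f5Count_add w I d e] at h1
    omega

lemma card_lmFinset_sup_span (w : MonomialOrder (Fin n)) {I J : Ideal (MvPolynomial (Fin n) K)}
    (hI : HomIdeal I) {g : MvPolynomial (Fin n) K} {e : ℕ} (hg : g.IsHomogeneous e)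
    (hJ : HomIdeal J) (hJI : J = I ⊔ Ideal.span {g}) (d : ℕ) (h0 : g ≠ 0)
    (hreg : ∀ b, b * g ∈ I → b ∈ I) :
    (lmFinset w J d).card = (lmFinset w I d).card + f5Count w I d e := by
  rcases lt_or_ge d e with h | h
  · rw [f5Count_of_lt w I h, ← finrank_gradedPart w hI, ← finrank_gradedPart w hJ, hJI,
      gradedPart_sup_span_of_lt hI hg h, add_zero]
  · obtain ⟨d, rfl⟩ := Nat.exists_eq_add_of_le' h
    have h1 := finrank_gradedPart_sup_span hI hg d h0 hreg
    rw [← hJI, finrank_gradedPart w hI, finrank_gradedPart w hI, finrank_gradedPart w hJ,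
      finrank_gradedPart w homIdeal_top, ← f5Count_add w I d e] at h1
    omega

/-! ### Regular sequences -/

section Regular

variable {f : Fin s → MvPolynomial (Fin n) K}

lemma ofList_ofFn_take_smul_top (f : Fin s → MvPolynomial (Fin n) K) (i : ℕ) :
    Ideal.ofList (List.take i (List.ofFn f)) • (⊤ : Submodule (MvPolynomial (Fin n) K)
      (MvPolynomial (Fin n) K)) = idealUpTo f i := by
  rw [smul_eq_mul, Ideal.mul_top, Ideal.ofList, idealUpTo]
  congr 1
  ext p
  change p ∈ List.take i (List.ofFn f) ↔ _
  rw [List.mem_take_iff_getElem]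
  constructor
  · rintro ⟨j, hj, rfl⟩
    simp only [List.length_ofFn, lt_min_iff] at hj
    exact ⟨⟨j, hj.2⟩, hj.1, by simp⟩
  · rintro ⟨j, hj, rfl⟩
    exact ⟨j, by simp [hj], by simp⟩

lemma idealUpTo_ne_top
    (hreg : RingTheory.Sequence.IsRegular (MvPolynomial (Fin n) K) (List.ofFn f)) :
    idealUpTo f s ≠ ⊤ := by
  have h := hreg.top_ne_smul
  rw [← ofList_ofFn_take_smul_top, List.take_of_length_le (by simp)]
  exact h.symm

lemma mem_of_mul_mem_idealUpTo
    (hreg : RingTheory.Sequence.IsRegular (MvPolynomial (Fin n) K) (List.ofFn f)) (i : Fin s)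
    {b : MvPolynomial (Fin n) K} (hb : b * f i ∈ idealUpTo f i) : b ∈ idealUpTo f i := by
  have h := hreg.toIsWeaklyRegular.regular_mod_prev i (by simp)
  rw [ofList_ofFn_take_smul_top] at h
  simp only [List.getElem_ofFn, Fin.eta] at h
  rw [← Ideal.Quotient.eq_zero_iff_mem]
  apply h
  change f i • (Submodule.Quotient.mk b : MvPolynomial (Fin n) K ⧸ idealUpTo f i)
    = f i • (0 : MvPolynomial (Fin n) K ⧸ idealUpTo f i)
  rw [smul_zero, ← Submodule.Quotient.mk_smul, Submodule.Quotient.mk_eq_zero, smul_eq_mul,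
    mul_comm]
  exact hb

lemma ne_zero_of_isRegular
    (hreg : RingTheory.Sequence.IsRegular (MvPolynomial (Fin n) K) (List.ofFn f)) (i : Fin s) :
    f i ≠ 0 := by
  intro h
  have h1 : (1 : MvPolynomial (Fin n) K) ∈ idealUpTo f i :=
    mem_of_mul_mem_idealUpTo hreg i (by simp [h])
  exact idealUpTo_ne_top hreg ((Ideal.eq_top_iff_one _).2 (idealUpTo_mono f i.2.le h1))

/-- A non-zero constant would generate the unit ideal. Positivity ensures that the matrix consulted
for the F5 criterion belongs to a degree already finished. -/
lemma deg_pos_of_isRegular {deg : Fin s → ℕ} (hf : ∀ i, (f i).IsHomogeneous (deg i))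
    (hreg : RingTheory.Sequence.IsRegular (MvPolynomial (Fin n) K) (List.ofFn f)) (i : Fin s) :
    0 < deg i := by
  by_contra h
  have h0 : deg i = 0 := by omega
  have hi := hf i
  rw [h0, ← totalDegree_zero_iff_isHomogeneous, totalDegree_eq_zero_iff_eq_C] at hi
  have hc : (f i).coeff 0 ≠ 0 := by
    intro hc
    rw [hc, C_0] at hi
    exact ne_zero_of_isRegular hreg i hi
  refine idealUpTo_ne_top hreg (Ideal.eq_top_of_isUnit_mem _ (mem_idealUpTo f i.2) ?_)
  rw [hi]
  exact (isUnit_iff_ne_zero.2 hc).map C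

end Regular

/-! ### The rows kept by the F5 criterion span -/

lemma F5Rows_mono (w : MonomialOrder (Fin n)) (f : Fin s → MvPolynomial (Fin n) K)
    (deg : Fin s → ℕ) (d : ℕ) {i j : ℕ} (h : i ≤ j) : F5Rows w f deg d i ⊆ F5Rows w f deg d j :=
  fun _ hp => ⟨⟨hp.1.1.trans_le h, hp.1.2⟩, hp.2⟩

/-- A cofactor of the last generator is replaced by its normal form modulo the preceding ideal: the
difference contributes to that ideal, covered by induction, and the normal form only uses monomials
that the criterion keeps. -/
lemma gradedPart_le_span_F5Rows (w : MonomialOrder (Fin n)) {f : Fin s → MvPolynomial (Fin n) K}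
    {deg : Fin s → ℕ} (hf : ∀ i, (f i).IsHomogeneous (deg i)) (d : ℕ) {i : ℕ} (hi : i ≤ s) :
    gradedPart (idealUpTo f i) d
      ≤ Submodule.span K ((fun p => monomial p.2 (1 : K) * f p.1) '' F5Rows w f deg d i) := by
  induction i with
  | zero =>
    intro p hp
    have := (mem_gradedPart.1 hp).1
    rw [idealUpTo_zero, Ideal.mem_bot] at this
    rw [this]
    exact Submodule.zero_mem _
  | succ i ih =>
    have hprev := (ih (by omega)).trans
      (Submodule.span_mono (Set.image_mono (F5Rows_mono w f deg d (Nat.le_succ i))))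
    have hI := homIdeal_idealUpTo hf i
    have hsucc := idealUpTo_succ f ⟨i, hi⟩
    simp only at hsucc
    rw [hsucc]
    rcases lt_or_ge d (deg ⟨i, hi⟩) with h | h
    · rw [gradedPart_sup_span_of_lt hI (hf _) h]
      exact hprev
    · obtain ⟨d, rfl⟩ := Nat.exists_eq_add_of_le' h
      intro p hp
      obtain ⟨a, ha, b, hb, rfl⟩ := mem_gradedPart_sup_span hI (hf _) d hp
      obtain ⟨a', ha', r, rfl, hr, hrLM⟩ := exists_normalForm w hI hb
      have ha'd : a'.IsHomogeneous d := by simpa using hb.sub hr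
      rw [add_mul]
      refine Submodule.add_mem _ (hprev ha) (Submodule.add_mem _ (hprev ?_) ?_)
      · exact mem_gradedPart.2 ⟨Ideal.mul_mem_right _ _ ha', ha'd.mul (hf _)⟩
      · rw [r.as_sum, Finset.sum_mul]
        refine Submodule.sum_mem _ fun u hu => ?_
        have : monomial u (r.coeff u) * f ⟨i, hi⟩
            = r.coeff u • (monomial u (1 : K) * f ⟨i, hi⟩) := by
          rw [← smul_mul_assoc, smul_monomial, smul_eq_mul, mul_one]
        rw [this]
        refine Submodule.smul_mem _ _ (Submodule.subset_span ⟨(⟨i, hi⟩, u), ⟨⟨?_, ?_⟩, ?_⟩, rfl⟩)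
        · exact Nat.lt_succ_self i
        · have : u.degree = d := by
            by_contra h
            exact (mem_support_iff.1 hu) (hr.coeff_eq_zero h)
          simp [this]
        · exact hrLM u hu

/-! ### Independent columns and minors -/

lemma macCol_eq_getElem (w : MonomialOrder (Fin n)) {d b : ℕ} (h : b < (monList w d).length) :
    macCol w d b = (monList w d)[b] := by
  rw [macCol, List.getD_eq_getElem _ _ h]

lemma degree_macCol (w : MonomialOrder (Fin n)) {d b : ℕ} (h : b < (monList w d).length) :
    (macCol w d b).degree = d := by
  rw [macCol_eq_getElem w h, ← mem_monList (w := w)]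
  exact List.getElem_mem h

lemma macCol_lt (w : MonomialOrder (Fin n)) {d a b : ℕ} (hab : a < b)
    (h : b < (monList w d).length) : macCol w d b ≺[w] macCol w d a := by
  rw [macCol_eq_getElem w h, macCol_eq_getElem w (hab.trans h)]
  exact List.pairwise_iff_getElem.1 (pairwise_monList w d) a b (hab.trans h) h hab

/-- If the first `k` monomials of degree `d` are leading monomials, the first `k` columns of the
matrix built with the F5 criterion are linearly independent. -/
lemma linearIndependent_cols (w : MonomialOrder (Fin n)) {f : Fin s → MvPolynomial (Fin n) K}
    {deg : Fin s → ℕ} (hf : ∀ i, (f i).IsHomogeneous (deg i)) {d i k : ℕ} (hi : i ≤ s)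
    (hk : k ≤ (monList w d).length) (hLM : ∀ b < k, macCol w d b ∈ LM w (idealUpTo f i)) :
    LinearIndependent K (fun (b : Fin k) (p : F5Rows w f deg d i) =>
      macEntry f p.1 (macCol w d b)) := by
  rw [Fintype.linearIndependent_iff]
  intro g hg
  by_contra! hne
  obtain ⟨b₀, hb₀⟩ := hne
  -- The last column used by the relation carries its smallest monomial. An element of the ideal
  -- with this leading monomial vanishes at the earlier columns, so the relation evaluated on it has
  -- a single term.
  obtain ⟨b, hb, hmax⟩ := Finset.exists_max_image (Finset.univ.filter fun b => g b ≠ 0)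
    id ⟨b₀, by simpa using hb₀⟩
  let L : MvPolynomial (Fin n) K →ₗ[K] K := ∑ b, g b • lcoeff K (macCol w d b)
  have hL : ∀ q, L q = ∑ b, g b * q.coeff (macCol w d b) := fun q => by
    simp [L, LinearMap.sum_apply]
  -- A relation between columns is a linear form that kills the F5 rows, hence the whole graded part
  -- that they span.
  have hker : gradedPart (idealUpTo f i) d ≤ LinearMap.ker L := by
    refine (gradedPart_le_span_F5Rows w hf d hi).trans (Submodule.span_le.2 ?_)
    rintro _ ⟨p, hp, rfl⟩
    have := congrFun hg ⟨p, hp⟩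
    simp only [Finset.sum_apply, Pi.smul_apply, smul_eq_mul, Pi.zero_apply] at this
    change L _ = 0
    rw [hL]
    exact this
  have hbl : (b : ℕ) < (monList w d).length := b.2.trans_le hk
  obtain ⟨q, hq, hq0, hqb⟩ := (mem_LM_iff w (homIdeal_idealUpTo hf i)).1 (hLM b b.2)
  rw [degree_macCol w hbl] at hq
  have h0 : L q = 0 := hker hq
  rw [hL, Finset.sum_eq_single b, mul_eq_zero] at h0
  · rcases h0 with h0 | h0
    · exact (Finset.mem_filter.1 hb).2 h0
    · rw [← hqb] at h0
      exact (w.coeff_degree_ne_zero_iff.2 hq0) h0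
  · intro b' _ hb'
    rcases lt_or_gt_of_ne hb' with hlt | hlt
    · rw [w.coeff_eq_zero_of_lt, mul_zero]
      rw [hqb]
      exact macCol_lt w hlt hbl
    · have : g b' = 0 := by
        by_contra h
        exact absurd (hmax b' (by simpa using h)) (not_le.2 hlt)
      rw [this, zero_mul]
  · simp

lemma indepCols_spec (w : MonomialOrder (Fin n)) (f : Fin s → MvPolynomial (Fin n) K)
    (deg : Fin s → ℕ) (d i : ℕ) :
    indepCols w f deg d i ≤ (monList w d).length ∧
    LinearIndependent K (fun (b : Fin (indepCols w f deg d i)) (p : F5Rows w f deg d i) =>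
      macEntry f p.1 (macCol w d b)) :=
  Nat.sSup_mem (s := {l : ℕ | l ≤ (monList w d).length ∧
    LinearIndependent K (fun (b : Fin l) (p : F5Rows w f deg d i) =>
      macEntry f p.1 (macCol w d b))})
    ⟨0, Nat.zero_le _, linearIndependent_empty_type⟩ ⟨_, fun _ h => h.1⟩

lemma le_indepCols (w : MonomialOrder (Fin n)) {f : Fin s → MvPolynomial (Fin n) K}
    {deg : Fin s → ℕ} (hf : ∀ i, (f i).IsHomogeneous (deg i)) {d i k : ℕ} (hi : i ≤ s)
    (hk : k ≤ (monList w d).length) (hLM : ∀ b < k, macCol w d b ∈ LM w (idealUpTo f i)) :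
    k ≤ indepCols w f deg d i :=
  le_csSup (s := {l : ℕ | l ≤ (monList w d).length ∧
    LinearIndependent K (fun (b : Fin l) (p : F5Rows w f deg d i) =>
      macEntry f p.1 (macCol w d b))}) ⟨_, fun _ h => h.1⟩
    ⟨hk, linearIndependent_cols w hf hi hk hLM⟩

/-- Linearly independent columns have a non-zero minor. -/
lemma exists_det_ne_zero {S : Type*} {l : ℕ} (c : Fin l → S → K) (hc : LinearIndependent K c) :
    ∃ ρ : Fin l ↪ S, (Matrix.of fun a b : Fin l => c b (ρ a)).det ≠ 0 := by
  obtain ⟨κ, a, ha, hspan, hli⟩ := exists_linearIndependent' K fun (p : S) (b : Fin l) => c b p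
  -- A linear form that vanishes on all rows is a relation between the columns, so the rows span and
  -- contain a basis of `l` elements.
  have htop : Submodule.span K (Set.range fun (p : S) (b : Fin l) => c b p) = ⊤ := by
    by_contra hne
    obtain ⟨φ, hφ, hle⟩ := Submodule.exists_le_ker_of_lt_top _ (lt_top_iff_ne_top.2 hne)
    apply hφ
    rw [Fintype.linearIndependent_iff] at hc
    have h0 := hc (fun b => φ fun j => if b = j then 1 else 0) (by
      funext p
      have hp : φ (fun b => c b p) = 0 := hle (Submodule.subset_span ⟨p, rfl⟩)
      rw [LinearMap.pi_apply_eq_sum_univ] at hp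
      simpa [mul_comm] using hp)
    refine LinearMap.ext fun x => ?_
    rw [LinearMap.pi_apply_eq_sum_univ, LinearMap.zero_apply]
    exact Finset.sum_eq_zero fun b _ => by rw [h0 b, smul_zero]
  rw [htop] at hspan
  let B := Module.Basis.mk hli hspan.ge
  have : Fintype κ := FiniteDimensional.fintypeBasisIndex B
  have hcard : Fintype.card κ = l := by
    rw [← Module.finrank_eq_card_basis B, Module.finrank_fin_fun]
  let e : Fin l ≃ κ := (Fintype.equivFinOfCardEq hcard).symm
  refine ⟨⟨a ∘ e, ha.comp e.injective⟩, ?_⟩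
  rw [← isUnit_iff_ne_zero, ← Matrix.isUnit_iff_isUnit_det, ← Matrix.linearIndependent_rows_iff_isUnit]
  exact hli.comp e e.injective

lemma exists_minor_ne_zero_of_linearIndependent (w : MonomialOrder (Fin n))
    (f : Fin s → MvPolynomial (Fin n) K) (deg : Fin s → ℕ) (d i l : ℕ)
    (h : LinearIndependent K fun (b : Fin l) (p : F5Rows w f deg d i) =>
      macEntry f p.1 (macCol w d b)) :
    ∃ ρ : Fin l ↪ F5Rows w f deg d i,
      (Matrix.of fun a b : Fin l => macEntry f (ρ a).1 (macCol w d b)).det ≠ 0 := by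
  obtain ⟨ρ, hρ⟩ := exists_det_ne_zero _ h
  exact ⟨ρ, hρ⟩

/-- There is a non-zero minor on the first `indepCols` columns, even with rows kept by the F5
criterion. -/
lemma exists_minor_ne_zero (w : MonomialOrder (Fin n)) (f : Fin s → MvPolynomial (Fin n) K)
    (deg : Fin s → ℕ) (d i : ℕ) :
    ∃ ρ : Fin (indepCols w f deg d i) ↪ F5Rows w f deg d i,
      (Matrix.of fun a b : Fin (indepCols w f deg d i) =>
        macEntry f (ρ a).1 (macCol w d b)).det ≠ 0 :=
  exists_minor_ne_zero_of_linearIndependent w f deg d i _ (indepCols_spec w f deg d i).2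

lemma le_val_macEntry {v : AddValuation K (WithTop ℤ)} {f : Fin s → MvPolynomial (Fin n) K}
    {B : WithTop ℤ} (hB : ∀ i u, B ≤ v ((f i).coeff u)) (p : Fin s × Mon n) (u : Mon n) :
    B ≤ v (macEntry f p u) := by
  rw [macEntry, coeff_monomial_mul']
  split_ifs
  · rw [one_mul]; exact hB _ _
  · simp

/-- Integrality makes the valuation of a non-zero minor a natural number, so the set in
`minMinorVal` is non-empty and its infimum is not the default value `0`. -/
lemma exists_minor_val_eq {v : AddValuation K (WithTop ℤ)} (w : MonomialOrder (Fin n))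
    {f : Fin s → MvPolynomial (Fin n) K} (hv : ∀ i u, 0 ≤ v ((f i).coeff u))
    (deg : Fin s → ℕ) (d i : ℕ) :
    ∃ k : ℕ, ∃ ρ : Fin (indepCols w f deg d i) ↪ F5Rows w f deg d i,
      v (Matrix.of fun a b : Fin (indepCols w f deg d i) =>
        macEntry f (ρ a).1 (macCol w d b)).det = ((k : ℤ) : WithTop ℤ) := by
  obtain ⟨ρ, hρ⟩ := exists_minor_ne_zero w f deg d i
  obtain ⟨t, ht⟩ := WithTop.ne_top_iff_exists.1 (v.ne_top_iff.2 hρ)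
  have h0 := le_val_det v (Matrix.of fun a b : Fin (indepCols w f deg d i) =>
        macEntry f (ρ a).1 (macCol w d b)) 0 fun a b => by
    simpa using le_val_macEntry hv _ _
  rw [← ht] at h0
  have h0' : 0 ≤ t := by
    have : -((indepCols w f deg d i * 0 : ℕ) : ℤ) ≤ t := by exact_mod_cast h0
    simpa using this
  exact ⟨t.toNat, ρ, by rw [← ht, Int.toNat_of_nonneg h0']⟩

/-- Minors of the F5 matrix are minors of the full one. The infimum on the F5 side must be attained,
as an empty set would give `0`. -/
lemma minMinorVal_macRows_le {v : AddValuation K (WithTop ℤ)} (w : MonomialOrder (Fin n))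
    {f : Fin s → MvPolynomial (Fin n) K} (hv : ∀ i u, 0 ≤ v ((f i).coeff u))
    (deg : Fin s → ℕ) (d i : ℕ) :
    minMinorVal v w f d (MacRows n deg d i) (indepCols w f deg d i)
      ≤ minMinorVal v w f d (F5Rows w f deg d i) (indepCols w f deg d i) := by
  refine Nat.sInf_le ?_
  obtain ⟨ρ, hρ⟩ := Nat.sInf_mem (s := {k : ℕ | ∃ ρ : Fin (indepCols w f deg d i) ↪
      F5Rows w f deg d i, v (Matrix.of fun a b : Fin (indepCols w f deg d i) =>
        macEntry f (ρ a).1 (macCol w d b)).det = ((k : ℤ) : WithTop ℤ)})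
    (exists_minor_val_eq w hv deg d i)
  exact ⟨ρ.trans (Set.embeddingOfSubset _ _ fun p hp => hp.1), hρ⟩

lemma exists_minor_val_eq_minMinorVal {v : AddValuation K (WithTop ℤ)}
    (w : MonomialOrder (Fin n)) {f : Fin s → MvPolynomial (Fin n) K}
    (hv : ∀ i u, 0 ≤ v ((f i).coeff u)) (deg : Fin s → ℕ) (d i : ℕ) :
    ∃ ρ : Fin (indepCols w f deg d i) → MacRows n deg d i,
      v (Matrix.of fun a b : Fin (indepCols w f deg d i) =>
        macEntry f (ρ a).1 (macCol w d b)).det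
      = ((minMinorVal v w f d (MacRows n deg d i) (indepCols w f deg d i) : ℤ) : WithTop ℤ) := by
  obtain ⟨k, ρ, hρ⟩ := exists_minor_val_eq w hv deg d i
  obtain ⟨ρ', hρ'⟩ := Nat.sInf_mem (s := {k : ℕ | ∃ ρ : Fin (indepCols w f deg d i) ↪
      MacRows n deg d i, v (Matrix.of fun a b : Fin (indepCols w f deg d i) =>
        macEntry f (ρ a).1 (macCol w d b)).det = ((k : ℤ) : WithTop ℤ)})
    ⟨k, ρ.trans (Set.embeddingOfSubset _ _ fun p hp => hp.1), hρ⟩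
  exact ⟨ρ', hρ'⟩

/-! ### Weakly-`w`-ideals -/

/-- A leading monomial of degree `d` of a weakly-`w`-ideal either indexes one of the first
`indepCols` columns or is the multiple of a leading monomial by a variable. -/
lemma exists_add_single_of_isWeaklyIdeal (w : MonomialOrder (Fin n))
    {f : Fin s → MvPolynomial (Fin n) K} {deg : Fin s → ℕ}
    (hf : ∀ i, (f i).IsHomogeneous (deg i)) {i : ℕ} (hi : i ≤ s)
    (hw : IsWeaklyIdeal w (idealUpTo f i)) {u : Mon n} (hu : u ∈ LM w (idealUpTo f i))
    (hcol : u ∉ (monList w u.degree).take (indepCols w f deg u.degree i)) :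
    ∃ k u', u' + Finsupp.single k 1 = u ∧ u' ∈ LM w (idealUpTo f i) := by
  obtain ⟨G, ⟨hG, hdiv, -⟩, hgt⟩ := hw
  obtain ⟨p, hp, h0, rfl⟩ := hu
  obtain ⟨g, hg, hle⟩ := hdiv p hp h0
  have hgLM : w.degree g ∈ LM w (idealUpTo f i) := ⟨g, (hG g hg).1, (hG g hg).2.1, rfl⟩
  -- Either the monomial is that of a basis element, and all greater ones are leading monomials, or
  -- it is a proper multiple and a variable can be divided out.
  rcases eq_or_ne (w.degree g) (w.degree p) with heq | hne
  · exfalso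
    have hmem : w.degree p ∈ monList w (w.degree p).degree := mem_monList.2 rfl
    obtain ⟨j, hj, hju⟩ := List.getElem_of_mem hmem
    -- The columns `0, …, j`, with the monomial itself at `j`, form an initial segment of leading
    -- monomials.
    have hjk : j + 1 ≤ indepCols w f deg (w.degree p).degree i := by
      refine le_indepCols w hf hi hj fun b hb => ?_
      have hjc : macCol w (w.degree p).degree j = w.degree p := by
        rw [macCol_eq_getElem w hj, hju]
      rcases Nat.lt_succ_iff_lt_or_eq.1 hb with hlt | rfl
      · refine hgt g hg _ ?_ ?_
        · rw [degree_macCol w (hlt.trans hj), heq]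
        · rw [heq]
          conv_lhs => rw [← hjc]
          exact macCol_lt w hlt hj
      · rw [hjc, ← heq]
        exact hgLM
    refine hcol ?_
    rw [List.mem_take_iff_getElem]
    exact ⟨j, by omega, hju⟩
  · obtain ⟨k, hk⟩ : ∃ k, w.degree g k < w.degree p k := by
      by_contra! hcon
      exact hne (le_antisymm hle hcon)
    have hsingle : Finsupp.single k 1 ≤ w.degree p := by
      rw [Finsupp.single_le_iff]; omega
    refine ⟨k, w.degree p - Finsupp.single k 1, tsub_add_cancel_of_le hsingle,
      LM_upward w hgLM fun x => ?_⟩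
    have := hle x
    rw [Finsupp.tsub_apply]
    by_cases hx : x = k
    · subst hx; simp; omega
    · simpa [Finsupp.single_apply, Ne.symm hx] using this

end

/-! ### Correctness of one completed matrix -/

section

variable {K : Type u} [Field K] {v : AddValuation K (WithTop ℤ)} {n s : ℕ}

/-! ### Multiples of approximate polynomials -/

lemma ApproxPoly.Approximates.shift {P : ApproxPoly v n} {p : MvPolynomial (Fin n) K}
    (h : P.Approximates p) (α : Mon n) : (P.shift α).Approximates (monomial α (1 : K) * p) := by
  refine ⟨?_, fun u hu => ?_⟩
  · change (monomial α (1 : K) * p).IsHomogeneous (P.deg + α.degree)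
    rw [add_comm]
    exact (isHomogeneous_monomial 1 rfl).mul h.1
  · change u.degree = P.deg + α.degree at hu
    rw [coeff_monomial_mul']
    simp only [ApproxPoly.shift]
    split_ifs with hα
    · rw [one_mul]
      refine h.2 _ ?_
      have : (u - α).degree + α.degree = u.degree := by
        rw [← map_add, tsub_add_cancel_of_le hα]
      omega
    · exact Approx.mem_zero.2 rfl

lemma ApproxPoly.PrecGE.shift {P : ApproxPoly v n} {m : WithTop ℤ} (h : P.PrecGE m) (α : Mon n) :
    (P.shift α).PrecGE m := by
  intro u hu
  change u.degree = P.deg + α.degree at hu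
  simp only [ApproxPoly.shift]
  split_ifs with hα
  · refine h _ ?_
    have : (u - α).degree + α.degree = u.degree := by
      rw [← map_add, tsub_add_cancel_of_le hα]
    omega
  · simp

lemma ApproxPoly.HasLead.shift {w : MonomialOrder (Fin n)} {P : ApproxPoly v n} {u : Mon n}
    (h : P.HasLead w u) (α : Mon n) : (P.shift α).HasLead w (u + α) := by
  obtain ⟨h1, h2, h3⟩ := h
  refine ⟨?_, ?_, fun x hx hux => ?_⟩
  · change (u + α).degree = P.deg + α.degree
    rw [map_add, h1]
  · simpa [ApproxPoly.shift] using h2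
  · change x.degree = P.deg + α.degree at hx
    simp only [ApproxPoly.shift]
    split_ifs with hα
    · have hadd : (x - α) + α = x := tsub_add_cancel_of_le hα
      refine h3 _ ?_ ?_
      · rw [← hadd, map_add] at hx
        omega
      · rw [← hadd, map_add, map_add] at hux
        exact lt_of_add_lt_add_right hux
    · rfl

/-- An unambiguous leading monomial is shared by all lifts; exact zeros, unlike small unknown
entries, cannot lift to greater terms. -/
lemma ApproxPoly.HasLead.degree_eq {w : MonomialOrder (Fin n)} {P : ApproxPoly v n} {u : Mon n}
    (h : P.HasLead w u) {p : MvPolynomial (Fin n) K} (hp : P.Approximates p) :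
    p ≠ 0 ∧ w.degree p = u := by
  have hu : p.coeff u ≠ 0 := Approx.ne_zero_of_isNonzero (hp.2 u h.1) h.2.1
  refine ⟨by rintro rfl; simp at hu, degree_eq_of_coeff w hu fun x hx => ?_⟩
  by_cases hd : x.degree = P.deg
  · have := hp.2 x hd
    rwa [h.2.2 x hd hx, Approx.mem_zero] at this
  · exact hp.1.coeff_eq_zero hd

/-! ### The full Macaulay matrix -/

lemma mem_cofactors {w : MonomialOrder (Fin n)} {d e : ℕ} {α : Mon n} :
    α ∈ cofactors w d e ↔ α.degree + e = d := by
  unfold cofactors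
  split_ifs with h
  · rw [mem_monList]; omega
  · simp; omega

/-- The labels of the rows of `macMatrix`, in order. -/
def macLabels (w : MonomialOrder (Fin n)) (deg : Fin s → ℕ) (d : ℕ) (i : Fin s) :
    List (Fin s × Mon n) :=
  ((List.finRange s).filter (fun j => j ≤ i)).flatMap fun j =>
    (cofactors w d (deg j)).map fun α => (j, α)

lemma mem_macLabels {w : MonomialOrder (Fin n)} {deg : Fin s → ℕ} {d : ℕ} {i : Fin s}
    {x : Fin s × Mon n} : x ∈ macLabels w deg d i ↔ x ∈ MacRows n deg d (i + 1) := by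
  obtain ⟨j, α⟩ := x
  simp only [macLabels, List.mem_flatMap, List.mem_filter, List.mem_finRange, true_and,
    decide_eq_true_eq, List.mem_map, mem_cofactors, Prod.mk.injEq]
  change _ ↔ (j : ℕ) < i + 1 ∧ α.degree + deg j = d
  constructor
  · rintro ⟨j, hj, α, hα, rfl, rfl⟩
    exact ⟨Nat.lt_succ_of_le hj, hα⟩
  · rintro ⟨hj, hα⟩
    exact ⟨j, Nat.le_of_lt_succ hj, α, hα, rfl, rfl⟩

lemma macMatrix_eq_map (w : MonomialOrder (Fin n)) (F : Fin s → ApproxPoly v n) (d : ℕ)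
    (i : Fin s) :
    macMatrix w F d i
      = (macLabels w (fun j => (F j).deg) d i).map fun x => (F x.1).shift x.2 := by
  simp [macMatrix, macLabels, List.map_flatMap, Function.comp_def]

/-! ### Completion -/

lemma exists_of_multipleWithLead {prev : List (EchRow v n)} {c : Mon n} {E : EchRow v n}
    (h : multipleWithLead prev c = some E) :
    ∃ P ∈ prev, ∃ k, P.lead + Finsupp.single k 1 = c ∧
      E = ⟨c, P.poly.shift (Finsupp.single k 1)⟩ := by
  obtain ⟨P, hP, h⟩ := List.exists_of_findSome?_eq_some h
  obtain ⟨k, -, h⟩ := List.exists_of_findSome?_eq_some h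
  split_ifs at h with hk
  exact ⟨P, hP, k, hk, (Option.some.inj h).symm⟩

lemma exists_multipleWithLead {prev : List (EchRow v n)} {P : EchRow v n} (hP : P ∈ prev)
    (k : Fin n) : ∃ E, multipleWithLead prev (P.lead + Finsupp.single k 1) = some E := by
  rw [← Option.isSome_iff_exists, ← Option.ne_none_iff_isSome]
  intro h
  rw [multipleWithLead, List.findSome?_eq_none_iff] at h
  have := List.findSome?_eq_none_iff.1 (h P hP) k (List.mem_finRange k)
  simp at this

/-- Each column yields at most one row, with that column as its leading monomial. Hence the
completed matrix has distinct leading monomials. -/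
lemma map_lead_filterMap_sublist (prev : List (EchRow v n)) (cols : List (Mon n)) :
    ((cols.filterMap (multipleWithLead prev)).map EchRow.lead).Sublist cols := by
  induction cols with
  | nil => simp
  | cons c cs ih =>
    cases h : multipleWithLead prev c with
    | none =>
      rw [List.filterMap_cons_none h]
      exact ih.cons c
    | some E =>
      rw [List.filterMap_cons_some h]
      obtain ⟨P, -, k, -, rfl⟩ := exists_of_multipleWithLead h
      exact ih.cons_cons c

lemma addNew_spec (G L : List (EchRow v n)) :
    (∀ g ∈ addNew G L, g ∈ G ∨ g ∈ L) ∧ (∀ g ∈ G, g ∈ addNew G L) ∧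
      ∀ r ∈ L, ∃ g ∈ addNew G L, g.lead = r.lead := by
  induction L generalizing G with
  | nil => simp [addNew]
  | cons r L ih =>
    obtain ⟨h1, h2, h3⟩ := ih (if ∃ g ∈ G, g.lead = r.lead then G else G ++ [r])
    have hunf : addNew G (r :: L)
        = addNew (if ∃ g ∈ G, g.lead = r.lead then G else G ++ [r]) L := rfl
    rw [hunf]
    split_ifs at h1 h2 h3 ⊢ with hex
    · refine ⟨fun g hg => ?_, h2, fun x hx => ?_⟩
      · rcases h1 g hg with h | h
        · exact Or.inl h
        · exact Or.inr (List.mem_cons_of_mem _ h)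
      · rcases List.mem_cons.1 hx with rfl | hx
        · obtain ⟨g, hg, hgr⟩ := hex
          exact ⟨g, h2 g hg, hgr⟩
        · exact h3 x hx
    · refine ⟨fun g hg => ?_, fun g hg => h2 g (by simp [hg]), fun x hx => ?_⟩
      · rcases h1 g hg with h | h
        · rcases List.mem_append.1 h with h | h
          · exact Or.inl h
          · exact Or.inr (by simp_all)
        · exact Or.inr (List.mem_cons_of_mem _ h)
      · rcases List.mem_cons.1 hx with rfl | hx
        · exact ⟨x, h2 x (by simp), rfl⟩
        · exact h3 x hx

/-! ### Correctness of the completed matrices -/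

/-- `p` is a choice of exact polynomials represented by `F`. -/
def Represents (F : Fin s → ApproxPoly v n) (p : Fin s → MvPolynomial (Fin n) K) : Prop :=
  ∀ j, (F j).Approximates (p j)

/-- `L` is an echelonized matrix of degree `d` of the first `i` polynomials, of precision at
least `c`: whatever exact polynomials are represented by `F`, its rows lift to the ideal that
they generate and its leading monomials are those of that ideal. -/
structure IsEchelonOf (w : MonomialOrder (Fin n)) (F : Fin s → ApproxPoly v n) (c : ℤ) (d i : ℕ)
    (L : List (EchRow v n)) : Prop where
  nodup : (L.map EchRow.lead).Nodup
  deg : ∀ E ∈ L, E.poly.deg = d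
  hasLead : ∀ E ∈ L, E.poly.HasLead w E.lead
  prec : ∀ E ∈ L, E.poly.PrecGE (c : WithTop ℤ)
  lift : ∀ p, Represents F p → ∀ E ∈ L, ∃ q ∈ idealUpTo p i, E.poly.Approximates q
  mem_LM : ∀ p, Represents F p → ∀ x : Mon n, x.degree = d → x ∈ LM w (idealUpTo p i) →
    ∃ E ∈ L, E.lead = x

lemma IsEchelonOf.mem_LM_iff {w : MonomialOrder (Fin n)} {F : Fin s → ApproxPoly v n} {c : ℤ}
    {d i : ℕ} {L : List (EchRow v n)} (h : IsEchelonOf w F c d i L)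
    {p : Fin s → MvPolynomial (Fin n) K} (hp : Represents F p) {x : Mon n} (hx : x.degree = d) :
    x ∈ LM w (idealUpTo p i) ↔ ∃ E ∈ L, E.lead = x := by
  refine ⟨h.mem_LM p hp x hx, ?_⟩
  rintro ⟨E, hE, rfl⟩
  obtain ⟨q, hq, hEq⟩ := h.lift p hp E hE
  obtain ⟨h0, hd⟩ := (h.hasLead E hE).degree_eq hEq
  exact ⟨q, hq, h0, hd⟩

/-- Both sets are read off the same list `L`: this is how information on `f` passes to every other
representative. -/
lemma IsEchelonOf.lmFinset_eq {w : MonomialOrder (Fin n)} {F : Fin s → ApproxPoly v n} {c : ℤ}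
    {d i : ℕ} {L : List (EchRow v n)} (h : IsEchelonOf w F c d i L)
    {p p' : Fin s → MvPolynomial (Fin n) K} (hp : Represents F p) (hp' : Represents F p') :
    lmFinset w (idealUpTo p i) d = lmFinset w (idealUpTo p' i) d := by
  ext x
  rw [mem_lmFinset, mem_lmFinset]
  exact and_congr_right fun hx => by rw [h.mem_LM_iff hp hx, h.mem_LM_iff hp' hx]

lemma isEchelonOf_nil (w : MonomialOrder (Fin n)) (F : Fin s → ApproxPoly v n) (c : ℤ) (d : ℕ) :
    IsEchelonOf w F c d 0 [] where
  nodup := by simp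
  deg := by simp
  hasLead := by simp
  prec := by simp
  lift := by simp
  mem_LM p _ x _ hx := by
    rw [idealUpTo_zero, LM_bot] at hx
    exact hx.elim

/-- The hypotheses on exact polynomials `f` and their approximations `F` of precision `m` under
which the weak Matrix algorithm works up to degree `D` with a loss of precision of at most
`P`. -/
structure IsSetup (w : MonomialOrder (Fin n)) (D : ℕ) (f : Fin s → MvPolynomial (Fin n) K)
    (deg : Fin s → ℕ) (B : ℕ) (P : ℤ) (m : ℕ) (F : Fin s → ApproxPoly v n) : Prop where
  homog : ∀ i, (f i).IsHomogeneous (deg i)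
  regular : RingTheory.Sequence.IsRegular (MvPolynomial (Fin n) K) (List.ofFn f)
  weakly : ∀ i, 1 ≤ i → i ≤ s → IsWeaklyIdeal w (idealUpTo f i)
  bound : ∀ i u, ((-(B : ℤ) : ℤ) : WithTop ℤ) ≤ v ((f i).coeff u)
  minor : ∀ d ≤ D, ∀ i : ℕ, 1 ≤ i → i ≤ s →
    ∃ ρ : Fin (indepCols w f deg d i) → MacRows n deg d i,
      v (Matrix.of fun a b : Fin (indepCols w f deg d i) =>
        macEntry f (ρ a).1 (macCol w d b)).det
      ≤ ((P - indepCols w f deg d i * B : ℤ) : WithTop ℤ)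
  lt_prec : P < m
  input : IsApproxInput f deg m F

namespace IsSetup

variable {w : MonomialOrder (Fin n)} {D : ℕ} {f : Fin s → MvPolynomial (Fin n) K}
  {deg : Fin s → ℕ} {B : ℕ} {P : ℤ} {m : ℕ} {F : Fin s → ApproxPoly v n}

lemma represents (h : IsSetup w D f deg B P m F) : Represents F f := fun j => (h.input j).2.1

lemma homog_of_represents (h : IsSetup w D f deg B P m F)
    {p : Fin s → MvPolynomial (Fin n) K} (hp : Represents F p) (j : Fin s) :
    (p j).IsHomogeneous (deg j) := by
  have := (hp j).1
  rwa [(h.input j).1] at this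

/-- Gaussian elimination of the full approximate Macaulay matrix finds exactly `indepCols`
pivots. -/
lemma exists_echelon (h : IsSetup w D f deg B P m F) {d : ℕ} (hd : d ≤ D) (i : Fin s) :
    ∃ ech, (echelon (monList w d) (macMatrix w F d i)).result = some ech ∧
      ech.length = indepCols w f deg d (i + 1) ∧
      ech.map EchRow.lead = (monList w d).take (indepCols w f deg d (i + 1)) ∧
      ∀ E ∈ ech, E.poly.deg = d ∧ E.poly.HasLead w E.lead ∧
        E.poly.PrecGE ((m - P : ℤ) : WithTop ℤ) ∧
        ∀ p, Represents F p → ∃ q ∈ idealUpTo p (i + 1), E.poly.Approximates q := by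
  have hdeg : (fun j => (F j).deg) = deg := funext fun j => (h.input j).1
  have hlab : macMatrix w F d i = (macLabels w deg d i).map fun x => (F x.1).shift x.2 := by
    rw [macMatrix_eq_map, hdeg]
  have hrows : ∀ Q ∈ macMatrix w F d i, RowOn d (monList w d) Q := by
    intro Q hQ
    rw [hlab] at hQ
    obtain ⟨x, hx, rfl⟩ := List.mem_map.1 hQ
    have hx' : x.2.degree + deg x.1 = d := (mem_macLabels.1 hx).2
    refine ⟨?_, fun u hu hu' => absurd (mem_monList.2 hu) hu'⟩
    change (F x.1).deg + x.2.degree = d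
    rw [(h.input x.1).1]
    omega
  obtain ⟨ech, h1, h2, h3, h4⟩ := echelon_spec w d (monList w d) (pairwise_monList w d)
    (fun u hu => mem_monList.1 hu) (macMatrix w F d i) hrows
  have hlift : ∀ p, Represents F p → ∀ E ∈ ech, ∃ q ∈ idealUpTo p (i + 1),
      E.poly.Approximates q := by
    intro p hp
    refine h4 ((idealUpTo p (i + 1)).restrictScalars K) ?_
    intro Q hQ
    rw [hlab] at hQ
    obtain ⟨x, hx, rfl⟩ := List.mem_map.1 hQ
    exact ⟨monomial x.2 1 * p x.1,
      Ideal.mul_mem_left _ _ (mem_idealUpTo p (mem_macLabels.1 hx).1), (hp x.1).shift x.2⟩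
  obtain ⟨ρ, hρ⟩ := h.minor d hd (i + 1) (Nat.le_add_left _ _) i.2
  have hindep := (indepCols_spec w f deg d (i + 1)).1
  obtain ⟨-, h6, h7⟩ := echelon_prec d B (monList w d) (fun u hu => mem_monList.1 hu)
    (macMatrix w F d i) hrows
    ((macLabels w deg d i).map fun x => monomial x.2 (1 : K) * f x.1) m
    (by
      rw [hlab, List.forall₂_map_left_iff, List.forall₂_map_right_iff, List.forall₂_same]
      intro x _
      exact ⟨(h.represents x.1).shift x.2, (h.input x.1).2.2.shift x.2,
        le_val_macEntry h.bound x⟩)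
    (indepCols w f deg d (i + 1)) hindep P
    (fun a => monomial (ρ a).1.2 (1 : K) * f (ρ a).1.1)
    (fun a => List.mem_map.2 ⟨(ρ a).1, mem_macLabels.2 (ρ a).2, rfl⟩) hρ
    (by have := h.lt_prec; omega) ech h1
  have hlen : ech.length ≤ (monList w d).length := by
    have := congrArg List.length h2
    rw [List.length_map, List.length_take] at this
    omega
  -- Pivots yield an initial segment of leading monomials of the ideal of `f`. The bound is
  -- essential, since `echelon_prec` controls the precision of the first `indepCols` pivots only.
  have hle : ech.length ≤ indepCols w f deg d (i + 1) := by
    refine le_indepCols w h.homog i.2 hlen fun b hb => ?_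
    have hb' : b < (ech.map EchRow.lead).length := by simpa using hb
    have hcol : macCol w d b = (ech[b]).lead := by
      rw [macCol_eq_getElem w (hb.trans_le hlen), ← List.getElem_map EchRow.lead (h := hb')]
      simp [h2]
    have hmem : ech[b] ∈ ech := List.getElem_mem hb
    obtain ⟨q, hq, hEq⟩ := hlift f h.represents _ hmem
    obtain ⟨h0, hqd⟩ := (h3 _ hmem).2.degree_eq hEq
    rw [hcol]
    exact ⟨q, hq, h0, hqd⟩
  have heq : ech.length = indepCols w f deg d (i + 1) := le_antisymm hle h6
  refine ⟨ech, h1, heq, by rw [h2, heq], fun E hE => ⟨(h3 E hE).1, (h3 E hE).2, ?_,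
    fun p hp => hlift p hp E hE⟩⟩
  refine h7 E ?_
  rwa [← heq, List.take_length]

/-- The criterion as run by the algorithm, on leading monomials of computed rows, agrees with the
true one for every representative; the right-hand side does not involve `p`. -/
lemma f5Count_eq (h : IsSetup w D f deg B P m F) {d : ℕ} {i : Fin s} {c : ℤ}
    {low : List (EchRow v n)}
    (hlow : deg i ≤ d → IsEchelonOf w F c (d - deg i) i low)
    {p : Fin s → MvPolynomial (Fin n) K} (hp : Represents F p) :
    f5Count w (idealUpTo p i) d (deg i) = ((cofactors w d (F i).deg).filter
      (fun α => ¬ ∃ r ∈ low, r.lead = α)).length := by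
  rw [f5Count, (h.input i).1]
  congr 1
  refine List.filter_congr fun α hα => ?_
  rw [mem_cofactors] at hα
  have := (hlow (by omega)).mem_LM_iff hp (x := α) (by omega)
  simp only [this]

/-- The Hilbert function of the ideals counts the rows kept by the F5 criterion. -/
lemma card_lmFinset_succ (h : IsSetup w D f deg B P m F) (d : ℕ) (i : Fin s) :
    (lmFinset w (idealUpTo f (i + 1)) d).card
      = (lmFinset w (idealUpTo f i) d).card + f5Count w (idealUpTo f i) d (deg i) :=
  card_lmFinset_sup_span w (homIdeal_idealUpTo h.homog i) (h.homog i)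
    (homIdeal_idealUpTo h.homog _) (idealUpTo_succ f i) d (ne_zero_of_isRegular h.regular i)
    fun _ => mem_of_mul_mem_idealUpTo h.regular i

/-- The completion raises no error and yields an echelonized matrix of the ideal. -/
lemma exists_complete (h : IsSetup w D f deg B P m F) {d : ℕ} (i : Fin s)
    {prev same low : List (EchRow v n)}
    (hprev : d ≠ 0 → IsEchelonOf w F (m - P) (d - 1) (i + 1) prev) (hprev0 : d = 0 → prev = [])
    (hsame : IsEchelonOf w F (m - P) d i same)
    (hlow : deg i ≤ d → IsEchelonOf w F (m - P) (d - deg i) i low) {ech : List (EchRow v n)}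
    (hlen : ech.length = indepCols w f deg d (i + 1))
    (hlead : ech.map EchRow.lead = (monList w d).take (indepCols w f deg d (i + 1)))
    (hech : ∀ E ∈ ech, E.poly.deg = d ∧ E.poly.HasLead w E.lead ∧
        E.poly.PrecGE ((m - P : ℤ) : WithTop ℤ) ∧
        ∀ p, Represents F p → ∃ q ∈ idealUpTo p (i + 1), E.poly.Approximates q) :
    ∃ M, (complete (monList w d) ech prev
        (lmFinset w (idealUpTo f (i + 1)) d).card).result = some M ∧
      IsEchelonOf w F (m - P) d (i + 1) M := by
  set l := indepCols w f deg d (i + 1) with hl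
  set extra := ((monList w d).drop l).filterMap (multipleWithLead prev) with hextra
  have hsub : ((ech ++ extra).map EchRow.lead).Sublist (monList w d) := by
    rw [List.map_append, hlead]
    conv_rhs => rw [← List.take_append_drop l (monList w d)]
    exact (List.Sublist.refl _).append (map_lead_filterMap_sublist _ _)
  have hnodup : ((ech ++ extra).map EchRow.lead).Nodup := (nodup_monList w d).sublist hsub
  have hrows : ∀ E ∈ ech ++ extra, E.poly.deg = d ∧ E.poly.HasLead w E.lead ∧
        E.poly.PrecGE ((m - P : ℤ) : WithTop ℤ) ∧
        ∀ p, Represents F p → ∃ q ∈ idealUpTo p (i + 1), E.poly.Approximates q := by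
    intro E hE
    rcases List.mem_append.1 hE with hE | hE
    · exact hech E hE
    · obtain ⟨c, hc, hcE⟩ := List.mem_filterMap.1 hE
      obtain ⟨Q, hQ, k, rfl, rfl⟩ := exists_of_multipleWithLead hcE
      have hd0 : d ≠ 0 := by
        intro h0
        rw [hprev0 h0] at hQ
        simp at hQ
      have hp := hprev hd0
      refine ⟨?_, (hp.hasLead Q hQ).shift _, (hp.prec Q hQ).shift _, fun p hpF => ?_⟩
      · change Q.poly.deg + (Finsupp.single k 1).degree = d
        rw [hp.deg Q hQ, Finsupp.degree_single]
        omega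
      · obtain ⟨q, hq, hQq⟩ := hp.lift p hpF Q hQ
        exact ⟨_, Ideal.mul_mem_left _ _ hq, hQq.shift _⟩
  have hmemLM : ∀ p, Represents F p → ∀ E ∈ ech ++ extra,
      E.lead ∈ lmFinset w (idealUpTo p (i + 1)) d := by
    intro p hp E hE
    obtain ⟨h1, h2, -, h4⟩ := hrows E hE
    obtain ⟨q, hq, hEq⟩ := h4 p hp
    obtain ⟨h0, hqd⟩ := h2.degree_eq hEq
    exact mem_lmFinset.2 ⟨h2.1.trans h1, q, hq, h0, hqd⟩
  -- A leading monomial of the ideal of `f` is either a pivot column or, by the weak property, a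
  -- variable times one present in `prev`.
  have hf : ∀ x ∈ lmFinset w (idealUpTo f (i + 1)) d, ∃ E ∈ ech ++ extra, E.lead = x := by
    intro x hx
    obtain ⟨hxd, hxLM⟩ := mem_lmFinset.1 hx
    by_cases hcol : x ∈ (monList w d).take l
    · rw [← hlead] at hcol
      obtain ⟨E, hE, hEx⟩ := List.mem_map.1 hcol
      exact ⟨E, List.mem_append_left _ hE, hEx⟩
    · obtain ⟨k, x', rfl, hx'⟩ := exists_add_single_of_isWeaklyIdeal w h.homog i.2
        (h.weakly _ (Nat.le_add_left _ _) i.2) hxLM (by rwa [hxd])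
      rw [map_add, Finsupp.degree_single] at hxd
      obtain ⟨Q, hQ, rfl⟩ := (hprev (by omega)).mem_LM f h.represents x' (by omega) hx'
      obtain ⟨E, hE⟩ := exists_multipleWithLead hQ k
      refine ⟨E, List.mem_append_right _ (List.mem_filterMap.2 ⟨_, ?_, hE⟩), ?_⟩
      · have : Q.lead + Finsupp.single k 1 ∈ monList w d := by
          rw [mem_monList, map_add, Finsupp.degree_single, hxd]
        rw [← List.take_append_drop l (monList w d), List.mem_append] at this
        exact this.resolve_left hcol
      · obtain ⟨Q', -, k', -, rfl⟩ := exists_of_multipleWithLead hE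
        rfl
  have hcard : ((ech ++ extra).map EchRow.lead).toFinset.card = (ech ++ extra).length := by
    rw [List.toFinset_card_of_nodup hnodup, List.length_map]
  have hsubset : ∀ p, Represents F p →
      ((ech ++ extra).map EchRow.lead).toFinset ⊆ lmFinset w (idealUpTo p (i + 1)) d := by
    intro p hp x hx
    obtain ⟨E, hE, rfl⟩ := List.mem_map.1 (List.mem_toFinset.1 hx)
    exact hmemLM p hp E hE
  have hN : (lmFinset w (idealUpTo f (i + 1)) d).card = (ech ++ extra).length := by
    rw [← hcard]
    congr 1
    refine (Finset.Subset.antisymm (hsubset f h.represents) fun x hx => ?_).symm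
    obtain ⟨E, hE, rfl⟩ := hf x hx
    exact List.mem_toFinset.2 (List.mem_map_of_mem hE)
  -- Exactly as many multiples are available as are required, so `take` discards nothing.
  have htake : extra.take ((lmFinset w (idealUpTo f (i + 1)) d).card - ech.length) = extra := by
    refine List.take_of_length_le ?_
    rw [hN, List.length_append]
    omega
  refine ⟨ech ++ extra, ?_, ⟨hnodup, fun E hE => (hrows E hE).1, fun E hE => (hrows E hE).2.1,
    fun E hE => (hrows E hE).2.2.1, fun p hp E hE => (hrows E hE).2.2.2 p hp,
    fun p hp x hxd hx => ?_⟩⟩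
  · simp only [complete, hlen]
    rw [← hextra, ← hlen, htake, if_pos hN.symm]
    rfl
  · have hpd := h.homog_of_represents hp
    -- The ideal of `p` has at most as many leading monomials as there are rows, and it contains
    -- those of the rows; so the two sets coincide.
    have h1 := card_lmFinset_sup_span_le w (homIdeal_idealUpTo hpd i) (hpd i)
      (homIdeal_idealUpTo hpd _) (idealUpTo_succ p i) d
    rw [hsame.lmFinset_eq hp h.represents, h.f5Count_eq hlow hp,
      ← h.f5Count_eq hlow h.represents, ← h.card_lmFinset_succ, hN, ← hcard] at h1
    have h2 := Finset.eq_of_subset_of_card_le (hsubset p hp) h1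
    have h3 : x ∈ ((ech ++ extra).map EchRow.lead).toFinset := by
      rw [h2]; exact mem_lmFinset.2 ⟨hxd, hx⟩
    exact List.mem_map.1 (List.mem_toFinset.1 h3)

end IsSetup

end

/-! ### Loop invariants, uniform bounds and operation counts -/

section

variable {K : Type u} [Field K] {v : AddValuation K (WithTop ℤ)} {n s : ℕ}

/-! ### The loops of the algorithm -/

/-- The matrix of degree `d` of the first `i` polynomials is correct, and its leading monomials
are those of elements of `G`. -/
def IsTreated (w : MonomialOrder (Fin n)) (F : Fin s → ApproxPoly v n) (c : ℤ) (st : State v n)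
    (d i : ℕ) : Prop :=
  IsEchelonOf w F c d i (st.table d i) ∧ ∀ E ∈ st.table d i, ∃ g ∈ st.G, g.lead = E.lead

/-- The part of the loop invariant that holds at all times: all degrees less than `d` are
treated. -/
structure LoopInv (w : MonomialOrder (Fin n)) (F : Fin s → ApproxPoly v n) (c : ℤ) (d : ℕ)
    (st : State v n) : Prop where
  zero : ∀ e, st.table e 0 = []
  treated : ∀ e < d, ∀ i ≤ s, IsTreated w F c st e i
  hasLead : ∀ E ∈ st.G, E.poly.HasLead w E.lead
  prec : ∀ E ∈ st.G, E.poly.PrecGE (c : WithTop ℤ)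
  lift : ∀ p, Represents F p → ∀ E ∈ st.G, ∃ q ∈ idealUpTo p s, E.poly.Approximates q

/-- The invariant of the inner loop in degree `d`: the first `k` polynomials are treated. -/
structure InnerInv (w : MonomialOrder (Fin n)) (f : Fin s → MvPolynomial (Fin n) K)
    (F : Fin s → ApproxPoly v n) (c : ℤ) (d k : ℕ) (st : State v n) : Prop
    extends LoopInv w F c d st where
  current : ∀ i ≤ k, IsTreated w F c st d i
  length_mat : st.mat.length = (lmFinset w (idealUpTo f k) d).card

namespace IsSetup

variable {w : MonomialOrder (Fin n)} {D : ℕ} {f : Fin s → MvPolynomial (Fin n) K}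
  {deg : Fin s → ℕ} {B : ℕ} {P : ℤ} {m : ℕ} {F : Fin s → ApproxPoly v n}

lemma exists_step (h : IsSetup w D f deg B P m F) {d : ℕ} (hd : d ≤ D) (i : Fin s)
    {st : State v n} (hst : InnerInv w f F (m - P) d i st) :
    ∃ st', (step w F d st i).result = some st' ∧ InnerInv w f F (m - P) d (i + 1) st' := by
  have hdi := (h.input i).1
  -- This gives `d - deg i < d` when `deg i ≤ d`, so the matrix used by the criterion is covered by
  -- `treated`.
  have hpos := deg_pos_of_isRegular h.homog h.regular i
  have hlow : deg i ≤ d → IsEchelonOf w F (m - P) (d - deg i) i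
      (st.table (d - (F i).deg) i) := fun hle => by
    rw [hdi]
    exact (hst.treated _ (by omega) i i.2.le).1
  obtain ⟨ech, h1, h2, h3, h4⟩ := h.exists_echelon hd i
  obtain ⟨M, hM, hME⟩ := h.exists_complete i
    (prev := if d = 0 then [] else st.table (d - 1) (i + 1))
    (fun h0 => by
      rw [if_neg h0]
      exact (hst.treated (d - 1) (by omega) (i + 1) i.2).1)
    (fun h0 => by rw [if_pos h0]) (hst.current i le_rfl).1 hlow h2 h3 h4
  set mat := st.mat ++ (((cofactors w d (F i).deg).filter
    (fun α => ¬ ∃ r ∈ st.table (d - (F i).deg) i, r.lead = α)).map fun α => (F i).shift α)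
    with hmat
  have hlen : mat.length = (lmFinset w (idealUpTo f (i + 1)) d).card := by
    rw [hmat, List.length_append, List.length_map, hst.length_mat, h.card_lmFinset_succ,
      h.f5Count_eq hlow h.represents]
  obtain ⟨hG1, hG2, hG3⟩ := addNew_spec st.G M
  set st' : State v n := ⟨Function.update st.table d (Function.update (st.table d) (i + 1) M),
    mat, addNew st.G M⟩ with hst'
  have htab : ∀ e j : ℕ, (e ≠ d ∨ j ≠ i + 1) → st'.table e j = st.table e j := by
    intro e j hej
    rcases eq_or_ne e d with rfl | he
    · simp [hst', Function.update_of_ne (hej.resolve_left (not_not.2 rfl))]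
    · simp [hst', Function.update_of_ne he]
  have hkeep : ∀ e j : ℕ, (e ≠ d ∨ j ≠ i + 1) → IsTreated w F (m - P) st e j →
      IsTreated w F (m - P) st' e j := by
    intro e j hej hT
    rw [IsTreated, htab e j hej]
    refine ⟨hT.1, fun E hE => ?_⟩
    obtain ⟨g, hg, hgE⟩ := hT.2 E hE
    exact ⟨g, hG2 g hg, hgE⟩
  refine ⟨st', ?_, ⟨⟨fun e => ?_, fun e he j hj => ?_, fun E hE => ?_, fun E hE => ?_,
    fun p hp E hE => ?_⟩, fun j hj => ?_, hlen⟩⟩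
  · simp only [step, Comp.result_bind', h1, Option.bind_some]
    rw [← hmat, hlen, hM]
    rfl
  · rw [htab e 0 (Or.inr (Nat.succ_ne_zero _).symm)]
    exact hst.zero e
  · exact hkeep e j (Or.inl he.ne) (hst.treated e he j hj)
  · rcases hG1 E hE with hE | hE
    · exact hst.hasLead E hE
    · exact hME.hasLead E hE
  · rcases hG1 E hE with hE | hE
    · exact hst.prec E hE
    · exact hME.prec E hE
  · rcases hG1 E hE with hE | hE
    · exact hst.lift p hp E hE
    · obtain ⟨q, hq, hEq⟩ := hME.lift p hp E hE
      exact ⟨q, idealUpTo_mono p i.2 hq, hEq⟩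
  · rcases eq_or_ne j (i + 1) with rfl | hne
    · have : st'.table d (i + 1) = M := by simp [hst']
      rw [IsTreated, this]
      exact ⟨hME, hG3⟩
    · exact hkeep d j (Or.inr hne) (hst.current j (by omega))

lemma exists_innerLoop (h : IsSetup w D f deg B P m F) {d : ℕ} (hd : d ≤ D)
    {st : State v n} (hst : LoopInv w F (m - P) d st) :
    ∃ st', ((List.finRange s).foldlM (step w F d) { st with mat := [] }).result = some st' ∧
      LoopInv w F (m - P) (d + 1) st' := by
  obtain ⟨st', h1, h2⟩ := Comp.exists_foldlM (step w F d) (List.finRange s)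
    (fun k st => InnerInv w f F (m - P) d k st) { st with mat := [] }
    ⟨⟨hst.zero, hst.treated, hst.hasLead, hst.prec, hst.lift⟩, fun i hi => by
      -- Before the first polynomial the ideal is zero, and the empty matrix and the count `0` are
      -- correct for it.
      obtain rfl : i = 0 := by omega
      rw [IsTreated, hst.zero]
      exact ⟨isEchelonOf_nil w F _ d, by simp⟩, by
      rw [idealUpTo_zero]
      symm
      rw [List.length_nil, Finset.card_eq_zero, Finset.eq_empty_iff_forall_notMem]
      intro x hx
      have := (mem_lmFinset.1 hx).2
      rw [LM_bot] at this
      exact this⟩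
    (fun k hk st hst => by
      have hk' : k < s := by simpa using hk
      obtain ⟨st', h1, h2⟩ := h.exists_step hd ⟨k, hk'⟩ hst
      exact ⟨st', by simpa using h1, h2⟩)
  rw [List.length_finRange] at h2
  refine ⟨st', h1, h2.zero, fun e he i hi => ?_, h2.hasLead, h2.prec, h2.lift⟩
  rcases Nat.lt_succ_iff_lt_or_eq.1 he with he | rfl
  · exact h2.treated e he i hi
  · exact h2.current i hi

/-- Correctness and precision of the weak Matrix algorithm. -/
theorem exists_weakMatrix (h : IsSetup w D f deg B P m F) :
    ∃ G, (weakMatrix w D F).result = some G ∧ IsApproxDGroebner w D F G ∧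
      ∀ Q ∈ G, Q.PrecGE ((m - P : ℤ) : WithTop ℤ) := by
  obtain ⟨st, h1, h2⟩ := Comp.exists_foldlM
    (fun (st : State v n) d => (List.finRange s).foldlM (step w F d) { st with mat := [] })
    (List.range (D + 1)) (fun d st => LoopInv w F (m - P) d st) ⟨fun _ _ => [], [], []⟩
    ⟨fun _ => rfl, by simp, by simp, by simp, by simp⟩
    (fun d hd st hst => by
      have hd' : d < D + 1 := by simpa using hd
      obtain ⟨st', h1, h2⟩ := h.exists_innerLoop (Nat.le_of_lt_succ hd') hst
      exact ⟨st', by simpa using h1, h2⟩)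
  rw [List.length_range] at h2
  have hprec : ∀ Q ∈ st.G.map EchRow.poly, Q.PrecGE ((m - P : ℤ) : WithTop ℤ) := by
    intro Q hQ
    obtain ⟨E, hE, rfl⟩ := List.mem_map.1 hQ
    exact h2.prec E hE
  refine ⟨st.G.map EchRow.poly, ?_, ⟨fun p hp => ?_, fun Q hQ u hu => ?_, fun Q hQ => ?_⟩, hprec⟩
  · rw [weakMatrix, Comp.result_bind', h1]
    rfl
  · have hlift : ∀ j : Fin (st.G.map EchRow.poly).length, ∃ q ∈ idealUpTo p s,
        ((st.G.map EchRow.poly).get j).Approximates q := by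
      intro j
      obtain ⟨E, hE, hEj⟩ := List.mem_map.1 (List.get_mem (st.G.map EchRow.poly) j)
      rw [← hEj]
      exact h2.lift p hp E hE
    choose g hgI hg using hlift
    refine ⟨g, hg, fun j => ?_, fun q hq h0 e he hqe => ?_⟩
    · rw [← idealUpTo_last]
      exact hgI j
    · rw [← idealUpTo_last] at hq
      -- A homogeneous element of degree `e` has the leading monomial of a row of the full matrix of
      -- degree `e`, and `addNew` kept some element with that leading monomial.
      obtain ⟨hE, hcov⟩ := h2.treated e (Nat.lt_succ_of_le he) s le_rfl
      obtain ⟨E, hE, hEq⟩ := hE.mem_LM p hp _ (degree_degree_of_isHomogeneous w hqe h0)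
        ⟨q, hq, h0, rfl⟩
      obtain ⟨E', hE', hlead⟩ := hcov E hE
      obtain ⟨j, hj⟩ := List.get_of_mem (List.mem_map_of_mem (f := EchRow.poly) hE')
      have hgj := hg j
      rw [hj] at hgj
      obtain ⟨hg0, hgd⟩ := (h2.hasLead E' hE').degree_eq hgj
      exact ⟨j, hg0, by rw [hgd, hlead, hEq]⟩
  · refine le_trans ?_ (hprec Q hQ u hu)
    have := h.lt_prec
    exact_mod_cast (by omega : (0 : ℤ) ≤ m - P)
  · obtain ⟨E, hE, rfl⟩ := List.mem_map.1 hQ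
    exact ⟨E.lead, h2.hasLead E hE⟩

end IsSetup

/-! ### Existence of bounds -/

/-- There are finitely many non-zero coefficients. The default value in `untopD` plays no role,
since it would only be used at a zero coefficient. -/
lemma exists_coeff_bound (v : AddValuation K (WithTop ℤ)) (f : Fin s → MvPolynomial (Fin n) K) :
    ∃ B : ℕ, ∀ i u, ((-(B : ℤ) : ℤ) : WithTop ℤ) ≤ v ((f i).coeff u) := by
  refine ⟨Finset.univ.sup fun i => (f i).support.sup fun u =>
    (-(v ((f i).coeff u)).untopD 0).toNat, fun i u => ?_⟩
  by_cases h0 : (f i).coeff u = 0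
  · simp [h0]
  · obtain ⟨t, ht⟩ := WithTop.ne_top_iff_exists.1 (v.ne_top_iff.2 h0)
    have h1 : (-(v ((f i).coeff u)).untopD 0).toNat ≤ Finset.univ.sup fun i =>
        (f i).support.sup fun u => (-(v ((f i).coeff u)).untopD 0).toNat :=
      (Finset.le_sup (f := fun u => (-(v ((f i).coeff u)).untopD 0).toNat)
        (mem_support_iff.2 h0)).trans
        (Finset.le_sup (f := fun i => (f i).support.sup fun u =>
          (-(v ((f i).coeff u)).untopD 0).toNat) (Finset.mem_univ i))
    have h2 : (-t).toNat = (-(v ((f i).coeff u)).untopD 0).toNat := by rw [← ht]; rfl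
    rw [← h2] at h1
    rw [← ht]
    exact_mod_cast (by omega)

/-- Without integrality the budget must cover the valuation `t` of a non-zero minor plus `B` for
each of its columns; its maximum over the finitely many pairs `(d, i)` is taken. -/
lemma exists_minor_bound (v : AddValuation K (WithTop ℤ)) (w : MonomialOrder (Fin n)) (D : ℕ)
    (f : Fin s → MvPolynomial (Fin n) K) (deg : Fin s → ℕ) (B : ℕ) :
    ∃ P : ℕ, ∀ d ≤ D, ∀ i : ℕ, 1 ≤ i → i ≤ s →
      ∃ ρ : Fin (indepCols w f deg d i) → MacRows n deg d i,
        v (Matrix.of fun a b : Fin (indepCols w f deg d i) =>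
          macEntry f (ρ a).1 (macCol w d b)).det
        ≤ ((P - indepCols w f deg d i * B : ℤ) : WithTop ℤ) := by
  have h : ∀ q : ℕ × ℕ, ∃ t : ℤ, ∃ ρ : Fin (indepCols w f deg q.1 q.2) → MacRows n deg q.1 q.2,
      v (Matrix.of fun a b : Fin (indepCols w f deg q.1 q.2) =>
          macEntry f (ρ a).1 (macCol w q.1 b)).det = (t : WithTop ℤ) := by
    intro q
    obtain ⟨ρ, hρ⟩ := exists_minor_ne_zero w f deg q.1 q.2
    obtain ⟨t, ht⟩ := WithTop.ne_top_iff_exists.1 (v.ne_top_iff.2 hρ)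
    exact ⟨t, fun a => ⟨(ρ a).1, (ρ a).2.1⟩, ht.symm⟩
  choose t ρ hρ using h
  refine ⟨(Finset.range (D + 1) ×ˢ Finset.Icc 1 s).sup fun q =>
    (t q + indepCols w f deg q.1 q.2 * B).toNat, fun d hd i hi1 his => ⟨ρ (d, i), ?_⟩⟩
  have h1 : (t (d, i) + indepCols w f deg d i * B).toNat
      ≤ (Finset.range (D + 1) ×ˢ Finset.Icc 1 s).sup fun q =>
        (t q + indepCols w f deg q.1 q.2 * B).toNat :=
    Finset.le_sup (f := fun q => (t q + indepCols w f deg q.1 q.2 * B).toNat)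
      (Finset.mem_product.2 ⟨Finset.mem_range.2 (Nat.lt_succ_of_le hd),
        Finset.mem_Icc.2 ⟨hi1, his⟩⟩)
  refine (hρ (d, i)).le.trans ?_
  rw [WithTop.coe_le_coe]
  exact le_sub_iff_add_le.2 ((Int.self_le_toNat _).trans (Int.ofNat_le.2 h1))

/-! ### The number of operations -/

/-- With no variables the count falls from `1` in degree `0` to `0` in degree `1`, so monotonicity
in the degree needs `n ≠ 0`. -/
lemma length_monList_le (w : MonomialOrder (Fin n)) {d D : ℕ} (hn : n ≠ 0) (hd : d ≤ D) :
    (monList w d).length ≤ (n + D - 1).choose D := by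
  obtain ⟨k, rfl⟩ := Nat.exists_eq_succ_of_ne_zero hn
  rw [length_monList, show k.succ + d - 1 = k + d by omega, show k.succ + D - 1 = k + D by omega,
    ← Nat.choose_symm_add, ← Nat.choose_symm_add]
  exact Nat.choose_le_choose _ (by omega)

lemma length_macMatrix_le (w : MonomialOrder (Fin n)) (F : Fin s → ApproxPoly v n) {d D : ℕ}
    (hn : n ≠ 0) (hd : d ≤ D) (i : Fin s) :
    (macMatrix w F d i).length ≤ s * (n + D - 1).choose D := by
  rw [macMatrix, List.length_flatMap]
  refine (List.sum_le_card_nsmul _ ((n + D - 1).choose D) fun x hx => ?_).trans ?_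
  · obtain ⟨j, -, rfl⟩ := List.mem_map.1 hx
    rw [List.length_map, cofactors]
    split_ifs
    · exact length_monList_le w hn (by omega)
    · simp
  · rw [List.length_map, smul_eq_mul]
    refine Nat.mul_le_mul_right _ ((List.length_filter_le _ _).trans ?_)
    simp

lemma cost_complete (cols : List (Mon n)) (ech prev : List (EchRow v n)) (N : ℕ) :
    (complete cols ech prev N).cost = 0 := by
  simp only [complete]
  split_ifs <;> rfl

lemma cost_step_le (w : MonomialOrder (Fin n)) (F : Fin s → ApproxPoly v n) {d D : ℕ}
    (hn : n ≠ 0) (hd : d ≤ D) (st : State v n) (i : Fin s) :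
    (step w F d st i).cost ≤ (n + D - 1).choose D * (s * (n + D - 1).choose D *
      (3 + 2 * (n + D - 1).choose D)) := by
  simp only [step]
  refine (Comp.cost_bind_le' _ _ (cost_echelon_le _ _) (b := 0) fun ech _ =>
    Comp.cost_bind_le' _ _ (a := 0) (b := 0) (cost_complete _ _ _ _).le fun M _ => le_rfl).trans ?_
  have h1 := length_monList_le w hn hd
  have h2 := length_macMatrix_le w F hn hd i
  rw [add_zero]
  gcongr

/-- The constant `10` is `2 * 5`, from `D + 1 ≤ 2 * D` and `3 + 2 * N ≤ 5 * N`. -/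
lemma cost_weakMatrix_le (w : MonomialOrder (Fin n)) (D : ℕ) (F : Fin s → ApproxPoly v n)
    (hn : n ≠ 0) (hD : 1 ≤ D) :
    (weakMatrix w D F).cost ≤ 10 * (s ^ 2 * D * (n + D - 1).choose D ^ 3) := by
  have hN : 1 ≤ (n + D - 1).choose D := Nat.choose_pos (by omega)
  set N := (n + D - 1).choose D with hNdef
  have h1 : (weakMatrix w D F).cost ≤ (D + 1) * (s * (N * (s * N * (3 + 2 * N)))) := by
    have h2 := Comp.cost_foldlM_le
      (fun (st : State v n) d => (List.finRange s).foldlM (step w F d) { st with mat := [] })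
      (List.range (D + 1)) (s * (N * (s * N * (3 + 2 * N)))) (fun st d hd => by
        have h3 := Comp.cost_foldlM_le (step w F d) (List.finRange s) _
          (fun a x _ => cost_step_le w F hn (Nat.le_of_lt_succ (List.mem_range.1 hd)) a x)
          { st with mat := [] }
        rwa [List.length_finRange] at h3) ⟨fun _ _ => [], [], []⟩
    rw [List.length_range] at h2
    exact Comp.cost_bind_le' _ _ h2 (b := 0) fun st _ => le_rfl
  calc _ ≤ _ := h1
    _ ≤ (2 * D) * (s * (N * (s * N * (5 * N)))) := by gcongr <;> omega
    _ = _ := by ring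

/-- Without variables every polynomial has degree `0`, whereas the members of a regular sequence
have positive degree. -/
lemma numVars_ne_zero_of_isRegular {f : Fin s → MvPolynomial (Fin n) K} {deg : Fin s → ℕ}
    (hf : ∀ i, (f i).IsHomogeneous (deg i))
    (hreg : RingTheory.Sequence.IsRegular (MvPolynomial (Fin n) K) (List.ofFn f)) (hs : s ≠ 0) :
    n ≠ 0 := by
  rintro rfl
  have i : Fin s := ⟨0, Nat.pos_of_ne_zero hs⟩
  have h1 := deg_pos_of_isRegular hf hreg i
  have h2 := (hf i).inj_right (isHomogeneous_of_isEmpty _ _ (f i)) (ne_zero_of_isRegular hreg i)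
  omega

lemma cost_weakMatrix_of_isEmpty (w : MonomialOrder (Fin n)) (D : ℕ)
    (F : Fin 0 → ApproxPoly v n) : (weakMatrix w D F).cost = 0 := by
  have h2 := Comp.cost_foldlM_le
    (fun (st : State v n) d => (List.finRange 0).foldlM (step w F d) { st with mat := [] })
    (List.range (D + 1)) 0 (fun st d hd => le_rfl) ⟨fun _ _ => [], [], []⟩
  have h3 : (weakMatrix w D F).cost ≤ 0 + 0 :=
    Comp.cost_bind_le' _ _ (by simpa using h2) fun st _ => le_rfl
  omega

end

end WeakMatrix

end

/-! ### The theorem -/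

theorem theorem3p5 :
    ∃ C : ℕ, ∀ {K : Type*} [Field K] (v : AddValuation K (WithTop ℤ)) (n s : ℕ)
      (w : MonomialOrder (Fin n)) (D : ℕ) (f : Fin s → MvPolynomial (Fin n) K)
      (deg : Fin s → ℕ),
      WeakMatrix.IsCDVF v →
      (∀ i, (f i).IsHomogeneous (deg i)) →
      RingTheory.Sequence.IsRegular (MvPolynomial (Fin n) K) (List.ofFn f) →
      (∀ i, 1 ≤ i → i ≤ s → WeakMatrix.IsWeaklyIdeal w (WeakMatrix.idealUpTo f i)) →
      -- sufficiently large precision is enough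
      (∃ m₀ : ℕ, ∀ m : ℕ, m₀ ≤ m → ∀ F : Fin s → WeakMatrix.ApproxPoly v n,
        WeakMatrix.IsApproxInput f deg m F →
        ∃ G : List (WeakMatrix.ApproxPoly v n),
          (WeakMatrix.weakMatrix w D F).result = some G ∧
          WeakMatrix.IsApproxDGroebner w D F G) ∧
      -- explicit precision and loss of precision for integral polynomials
      ((∀ i u, 0 ≤ v ((f i).coeff u)) →
        WeakMatrix.precMac v w D f deg ≤ WeakMatrix.precMF5 v w D f deg ∧
        ∀ m : ℕ, WeakMatrix.precMac v w D f deg < m →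
          ∀ F : Fin s → WeakMatrix.ApproxPoly v n, WeakMatrix.IsApproxInput f deg m F →
          ∃ G : List (WeakMatrix.ApproxPoly v n),
            (WeakMatrix.weakMatrix w D F).result = some G ∧
            WeakMatrix.IsApproxDGroebner w D F G ∧
            ∀ P ∈ G, P.PrecGE
              (((m : ℤ) - (WeakMatrix.precMac v w D f deg : ℤ) : ℤ) : WithTop ℤ)) ∧
      -- number of operations
      (1 ≤ D → ∀ (m : ℕ) (F : Fin s → WeakMatrix.ApproxPoly v n),
        WeakMatrix.IsApproxInput f deg m F →
        (WeakMatrix.weakMatrix w D F).cost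
          ≤ C * (s ^ 2 * D * (n + D - 1).choose D ^ 3)) := by
  refine ⟨10, ?_⟩
  intro K _ v n s w D f deg _ hf hreg hweak
  refine ⟨?_, fun hv => ⟨?_, fun m hm F hF => ?_⟩, fun hD m F _ => ?_⟩
  · obtain ⟨B, hB⟩ := WeakMatrix.exists_coeff_bound v f
    obtain ⟨P, hP⟩ := WeakMatrix.exists_minor_bound v w D f deg B
    refine ⟨P + 1, fun m hm F hF => ?_⟩
    have hsetup : WeakMatrix.IsSetup w D f deg B P m F :=
      ⟨hf, hreg, hweak, hB, hP, by omega, hF⟩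
    obtain ⟨G, h1, h2, -⟩ := hsetup.exists_weakMatrix
    exact ⟨G, h1, h2⟩
  · exact Finset.sup_mono_fun fun q _ => WeakMatrix.minMinorVal_macRows_le w hv deg q.1 q.2
  -- For integral polynomials `B = 0`, and the required bound on a minor is exactly the Macaulay
  -- precision.
  · have hsetup : WeakMatrix.IsSetup w D f deg 0 (WeakMatrix.precMac v w D f deg) m F := by
      refine ⟨hf, hreg, hweak, fun i u => by simpa using hv i u, fun d hd i hi1 his => ?_,
        by exact_mod_cast hm, hF⟩
      obtain ⟨ρ, hρ⟩ := WeakMatrix.exists_minor_val_eq_minMinorVal w hv deg d i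
      refine ⟨ρ, hρ.le.trans ?_⟩
      have hle : WeakMatrix.minMinorVal v w f d (WeakMatrix.MacRows n deg d i)
          (WeakMatrix.indepCols w f deg d i) ≤ WeakMatrix.precMac v w D f deg :=
        Finset.le_sup (f := fun q : ℕ × ℕ => WeakMatrix.minMinorVal v w f q.1
          (WeakMatrix.MacRows n deg q.1 q.2) (WeakMatrix.indepCols w f deg q.1 q.2))
          (b := (d, i)) (Finset.mem_product.2 ⟨Finset.mem_range.2 (Nat.lt_succ_of_le hd),
            Finset.mem_Icc.2 ⟨hi1, his⟩⟩)
      rw [WithTop.coe_le_coe]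
      simpa using hle
    exact hsetup.exists_weakMatrix
  -- An empty sequence does not exclude `n = 0`, but then no operation is performed.
  · rcases Nat.eq_zero_or_pos s with rfl | hs
    · rw [WeakMatrix.cost_weakMatrix_of_isEmpty]
      exact Nat.zero_le _
    · exact WeakMatrix.cost_weakMatrix_le w D F
        (WeakMatrix.numVars_ne_zero_of_isRegular hf hreg hs.ne') hD
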